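/- Let $k\ge 0$ and let $\Lambda$ be a finite $k$-graph with no sources, i.e. a countable small category with a degree functor $d:\Lambda\to\mathbb N^k$ having the unique factorization property, such that $\Lambda^n=d^{-1}(n)$ is finite for every $n\in\mathbb N^k$ and $v\Lambda^n=\{\lambda\in\Lambda^n : r(\lambda)=v\}\neq\emptyset$ for every $v\in\Lambda^0$, $n\in\mathbb N^k$. Let $C^*(\Lambda)$ be the $C^*$-algebra generated by a universal Cuntz--Krieger $\Lambda$-family $\{s_\lambda:\lambda\in\Lambda\}$, i.e. partial isometries such that the $s_v$ ($v\in\Lambda^0$) are mutually orthogonal projections, $s_\lambda s_\nu=s_{\lambda\nu}$ when $s(\lambda)=r(\nu)$, $s_\lambda^*s_\lambda=s_{s(\lambda)}$, and $s_v=\sum_{\lambda\in v\Lambda^n}s_\lambda s_\lambda^*$ for all $v\in\Lambda^0$, $n\in\mathbb N^k$. Let $\gamma$ be the gauge action of $\mathbb T^k$ on $C^*(\Lambda)$, $\gamma_z(s_\lambda)=z^{d(\lambda)}s_\lambda$. A finite family of measurable maps $\sigma_i:D_i\to X$ on measurable subsets $D_i$ of a measure space $(X,\mu)$ is a semibranching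 function system if the sets $R_i=\sigma_i(D_i)$ are $\mu$-measurable, $\mu(X\setminus\bigcup_iR_i)=0$, $\mu(R_i\cap R_j)=0$ for $i\ne j$, and for each $i$ there is a Radon--Nikodym derivative $\Phi_{\sigma_i}=d(\mu\circ\sigma_i)/d\mu$ on $D_i$ (that is, $\mu(\sigma_i(E))=\int_E\Phi_{\sigma_i}\,d\mu$ for all measurable $E\subseteq D_i$) with $\Phi_{\sigma_i}>0$ a.e. on $D_i$. A coding map for the family is a measurable $\sigma:X\to X$ with $\sigma(\sigma_i(x))=x$ for all $i$ and all $x\in D_i$. A $\Lambda$-semibranching function system on $(X,\mu)$ consists of measurable sets $D_\lambda\subseteq X$, prefixing maps $\tau_\lambda:D_\lambda\to X$ $(\lambda\in\Lambda)$ and coding maps $\tau^m:X\to X$ $(m\in\mathbb N^k)$ such that, with $R_\lambda=\tau_\lambda(D_\lambda)$: (a) for each $m\in\mathbb N^k$, $\{\tau_\lambda:d(\lambda)=m\}$ is a semibranching function system with coding map $\tau^m$; (b) for each $v\in\Lambda^0$, $\tau_v=\mathrm{id}$ on $D_v$ and $\mu(D_v)>0$; (c) whenever $s(\lambda)=r(\nu)$,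 up to null sets $R_\nu\subseteq D_\lambda$ and $D_{\lambda\nu}=D_\nu$, and $\tau_\lambda\circ\tau_\nu=\tau_{\lambda\nu}$ almost everywhere on $D_\nu$; (d) $\tau^m\circ\tau^n=\tau^{m+n}$ for all $m,n\in\mathbb N^k$. Theorem. Suppose that a $\Lambda$-semibranching function system on a probability space $(X,\mu)$ is given, and that there are $\omega\in(0,\infty)$ and $C=(C_1,\dots,C_k)\in(0,\infty)^k$ such that, for every $\lambda\in\Lambda$, the Radon--Nikodym derivative of $\mu\circ\tau_\lambda$ with respect to $\mu$ on $D_\lambda$ is the constant $$\Phi_{\tau_\lambda}=C^{-\omega d(\lambda)}=\prod_{i=1}^kC_i^{-\omega d(\lambda)_i}.$$ Let $\alpha$ be the dynamics on $C^*(\Lambda)$ given by $\alpha_t=\gamma_{C^{it}}$, where $C^{it}=(C_1^{it},\dots,C_k^{it})$. Then there is a unique continuous linear functional $\phi$ on $C^*(\Lambda)$ such that $$\phi(s_\lambda s_\nu^*)=\delta_{\lambda,\nu}\,\mu(R_\lambda)\qquad\text{for all }\lambda,\nu\in\Lambda,$$ and $\phi$ is a KMS state of $(C^*(\Lambda),\alpha)$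 at inverse temperature $\omega$: it is a state, and $\phi(ab)=\phi(b\,\alpha_{i\omega}(a))$ for all $a,b\in C^*(\Lambda)$ that are analytic for $\alpha$, meaning that $t\mapsto\alpha_t(a)$ extends to an entire function $z\mapsto\alpha_z(a)$, and likewise for $b$. -/

import Mathlib

open scoped ENNReal
open CategoryTheory MeasureTheory

universe u

/-! ### Higher-rank graphs -/

/-- A `k`-graph: a countable small category with object set `V`, together with a degree functor to
`ℕ^k` having the unique factorization property.  A morphism `f : w ⟶ v` is a path with source `w`
and range `v`, and the path usually written `μν` (defined when the source of `μ` is the range of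
`ν`) is `ν ≫ μ` in Mathlib's notation. -/
structure KGraph (k : ℕ) (V : Type u) [SmallCategory V] where
  d : ∀ {w v : V}, (w ⟶ v) → (Fin k → ℕ)
  d_id : ∀ v : V, d (𝟙 v) = 0
  d_comp : ∀ {u w v : V} (ν : u ⟶ w) (μ : w ⟶ v), d (ν ≫ μ) = d μ + d ν
  factorization : ∀ {u v : V} (lam : u ⟶ v) (m n : Fin k → ℕ), d lam = m + n →
    ∃! p : Σ w : V, (u ⟶ w) × (w ⟶ v), p.2.1 ≫ p.2.2 = lam ∧ d p.2.2 = m ∧ d p.2.1 = n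
  countable_morphisms : Countable (Σ w : V, Σ v : V, (w ⟶ v))

namespace KGraph

variable {k : ℕ} {V : Type u} [SmallCategory V]

/-- The set of all (finite) paths of a `k`-graph, that is, the set of all morphisms. -/
structure Path (Λ : KGraph k V) where
  {s : V}
  {r : V}
  hom : s ⟶ r

/-- The degree of a path. -/
def degree (Λ : KGraph k V) (p : Λ.Path) : Fin k → ℕ := Λ.d p.hom

/-- The vertex `v` as a path, i.e. the identity morphism at `v`. -/
def vertex (Λ : KGraph k V) (v : V) : Λ.Path := ⟨𝟙 v⟩

/-- `Λ` is finite if there are only finitely many paths of each degree. -/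
class IsFinite (Λ : KGraph k V) : Prop where
  finite_degree : ∀ n : Fin k → ℕ, {p : Λ.Path | Λ.degree p = n}.Finite

/-- `Λ` has no sources: every vertex receives a path of every degree. -/
def NoSources (Λ : KGraph k V) : Prop :=
  ∀ (v : V) (n : Fin k → ℕ), ∃ p : Λ.Path, p.r = v ∧ Λ.degree p = n

theorem finite_into (Λ : KGraph k V) [Λ.IsFinite] (v : V) (n : Fin k → ℕ) :
    {p : Λ.Path | p.r = v ∧ Λ.degree p = n}.Finite :=
  (IsFinite.finite_degree n).subset fun _ hp => hp.2

/-- The finite set `vΛ^n` of paths with range `v` and degree `n`. -/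
noncomputable def into (Λ : KGraph k V) [Λ.IsFinite] (v : V) (n : Fin k → ℕ) : Finset Λ.Path :=
  (Λ.finite_into v n).toFinset

theorem mem_into (Λ : KGraph k V) [Λ.IsFinite] (v : V) (n : Fin k → ℕ) (p : Λ.Path) :
    p ∈ Λ.into v n ↔ p.r = v ∧ Λ.degree p = n := by
  simp [into]

/-! ### Cuntz-Krieger families and the C*-algebra of a `k`-graph -/

/-- A Cuntz-Krieger `Λ`-family in a C*-algebra `B`. -/
structure CKFamily (Λ : KGraph k V) [Λ.IsFinite] (B : Type*) [NonUnitalCStarAlgebra B] where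
  t : Λ.Path → B
  partialIsometry : ∀ p, t p * star (t p) * t p = t p
  vertex_proj : ∀ v : V, IsStarProjection (t (Λ.vertex v))
  vertex_orthogonal : ∀ v w : V, v ≠ w → t (Λ.vertex v) * t (Λ.vertex w) = 0
  mul : ∀ {u w v : V} (μ : w ⟶ v) (ν : u ⟶ w), t ⟨μ⟩ * t ⟨ν⟩ = t ⟨ν ≫ μ⟩
  star_mul_self : ∀ p, star (t p) * t p = t (Λ.vertex p.s)
  sum_range : ∀ (v : V) (n : Fin k → ℕ),
    t (Λ.vertex v) = ∑ p ∈ Λ.into v n, t p * star (t p)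

theorem CKFamily.norm_le_one {Λ : KGraph k V} [Λ.IsFinite] {B : Type*} [NonUnitalCStarAlgebra B]
    (T : CKFamily Λ B) (p : Λ.Path) : ‖T.t p‖ ≤ 1 := by
  have h1 : ‖T.t p‖ * ‖T.t p‖ ≤ 1 := by
    rw [← CStarRing.norm_star_mul_self, T.star_mul_self]
    exact (T.vertex_proj _).norm_le
  nlinarith [norm_nonneg (T.t p)]

/-- A Cuntz-Krieger `Λ`-family together with the C*-algebra in which it lives. -/
structure CKRep (Λ : KGraph k V) [Λ.IsFinite] where
  B : Type u
  [inst : NonUnitalCStarAlgebra B]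
  fam : CKFamily Λ B

attribute [instance] CKRep.inst

/-- The C*-algebra of bounded elements in the product over all Cuntz-Krieger `Λ`-families. -/
abbrev BigProd (Λ : KGraph k V) [Λ.IsFinite] : Type (u + 1) :=
  lp (fun i : CKRep Λ => i.B) ∞

/-- The element of the product whose coordinates are the `p`-th members of all families. -/
noncomputable def bigGen (Λ : KGraph k V) [Λ.IsFinite] (p : Λ.Path) : BigProd Λ :=
  ⟨fun i => i.fam.t p, memℓp_infty ⟨1, by rintro _ ⟨i, rfl⟩; exact i.fam.norm_le_one p⟩⟩

/-- The closed *-subalgebra generated by the product of all Cuntz-Krieger `Λ`-families. -/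
noncomputable def cstarSubalgebra (Λ : KGraph k V) [Λ.IsFinite] :
    NonUnitalStarSubalgebra ℂ (BigProd Λ) :=
  (NonUnitalStarAlgebra.adjoin ℂ (Set.range Λ.bigGen)).topologicalClosure

instance isClosed_cstarSubalgebra (Λ : KGraph k V) [Λ.IsFinite] :
    IsClosed (Λ.cstarSubalgebra : Set (BigProd Λ)) :=
  NonUnitalStarSubalgebra.isClosed_topologicalClosure _

/-- The Cuntz-Krieger C*-algebra `C*(Λ)`: the C*-algebra generated by a universal Cuntz-Krieger
`Λ`-family.  See `gen` for the universal family and `lift_gen` for its universal property. -/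
abbrev CStar (Λ : KGraph k V) [Λ.IsFinite] : Type (u + 1) := Λ.cstarSubalgebra

theorem bigGen_mem (Λ : KGraph k V) [Λ.IsFinite] (p : Λ.Path) :
    Λ.bigGen p ∈ Λ.cstarSubalgebra :=
  NonUnitalStarSubalgebra.le_topologicalClosure _
    (NonUnitalStarAlgebra.subset_adjoin ℂ _ ⟨p, rfl⟩)

/-- The generator `s_p` of `C*(Λ)`. -/
noncomputable def gen (Λ : KGraph k V) [Λ.IsFinite] (p : Λ.Path) : Λ.CStar :=
  ⟨Λ.bigGen p, Λ.bigGen_mem p⟩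

/-- The *-homomorphism from `C*(Λ)` determined by a Cuntz-Krieger `Λ`-family. -/
noncomputable def lift (Λ : KGraph k V) [Λ.IsFinite] (i : CKRep Λ) : Λ.CStar →⋆ₙₐ[ℂ] i.B where
  toFun a := (a : BigProd Λ) i
  map_smul' _ _ := rfl
  map_zero' := rfl
  map_add' _ _ := rfl
  map_mul' _ _ := rfl
  map_star' _ := rfl

theorem lift_gen (Λ : KGraph k V) [Λ.IsFinite] (i : CKRep Λ) (p : Λ.Path) :
    Λ.lift i (Λ.gen p) = i.fam.t p := rfl

theorem CStar.ext_lift {Λ : KGraph k V} [Λ.IsFinite] {a b : Λ.CStar}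
    (h : ∀ i, Λ.lift i a = Λ.lift i b) : a = b :=
  Subtype.ext (lp.ext (funext h))

/-- The generators of `C*(Λ)` form a Cuntz-Krieger `Λ`-family. -/
noncomputable def genFamily (Λ : KGraph k V) [Λ.IsFinite] : CKFamily Λ Λ.CStar where
  t := Λ.gen
  partialIsometry p := CStar.ext_lift fun i => by
    simp only [map_mul, map_star, lift_gen, i.fam.partialIsometry]
  vertex_proj v :=
    ⟨CStar.ext_lift fun i => by
      rw [map_mul, lift_gen]; exact (i.fam.vertex_proj v).isIdempotentElem,
     CStar.ext_lift fun i => by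
      rw [map_star, lift_gen]; exact (i.fam.vertex_proj v).isSelfAdjoint⟩
  vertex_orthogonal v w h := CStar.ext_lift fun i => by
    simp only [map_mul, map_zero, lift_gen, i.fam.vertex_orthogonal v w h]
  mul μ ν := CStar.ext_lift fun i => by
    simp only [map_mul, lift_gen, i.fam.mul]
  star_mul_self p := CStar.ext_lift fun i => by
    simp only [map_mul, map_star, lift_gen, i.fam.star_mul_self]
  sum_range v n := CStar.ext_lift fun i => by
    simp only [map_sum, map_mul, map_star, lift_gen]
    exact i.fam.sum_range v n

/-! ### The gauge action -/

/-- `z^n = ∏ z_i^{n_i}` for `z` in the `k`-torus. -/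
noncomputable def torusPow (z : Fin k → Circle) (n : Fin k → ℕ) : Circle := ∏ i, z i ^ n i

theorem torusPow_add (z : Fin k → Circle) (m n : Fin k → ℕ) :
    torusPow z (m + n) = torusPow z m * torusPow z n := by
  simp [torusPow, pow_add, Finset.prod_mul_distrib]

theorem torusPow_mul (z w : Fin k → Circle) (n : Fin k → ℕ) :
    torusPow (z * w) n = torusPow z n * torusPow w n := by
  simp [torusPow, mul_pow, Finset.prod_mul_distrib]

theorem torusPow_one (n : Fin k → ℕ) : torusPow (1 : Fin k → Circle) n = 1 := by
  simp [torusPow]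

theorem star_torusPow_mul_self (z : Fin k → Circle) (n : Fin k → ℕ) :
    star (torusPow z n : ℂ) * (torusPow z n : ℂ) = 1 := by
  rw [RCLike.star_def, mul_comm, Complex.mul_conj, Circle.normSq_coe, Complex.ofReal_one]

theorem torusPow_vertex {Λ : KGraph k V} (z : Fin k → Circle) (v : V) :
    (torusPow z (Λ.degree (Λ.vertex v)) : ℂ) = 1 := by
  simp [degree, vertex, Λ.d_id, torusPow]

/-- The Cuntz-Krieger family `p ↦ z^{d(p)} t_p`. -/
noncomputable def CKFamily.twist {Λ : KGraph k V} [Λ.IsFinite] {B : Type*}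
    [NonUnitalCStarAlgebra B] (T : CKFamily Λ B) (z : Fin k → Circle) : CKFamily Λ B where
  t p := (torusPow z (Λ.degree p) : ℂ) • T.t p
  partialIsometry p := by
    simp only [star_smul, smul_mul_assoc, mul_smul_comm, smul_smul, T.partialIsometry,
      star_torusPow_mul_self, mul_one]
  vertex_proj v := by rw [torusPow_vertex, one_smul]; exact T.vertex_proj v
  vertex_orthogonal v w h := by
    rw [torusPow_vertex, torusPow_vertex, one_smul, one_smul]; exact T.vertex_orthogonal v w h
  mul μ ν := by
    simp only [smul_mul_assoc, mul_smul_comm, smul_smul, T.mul, degree, Λ.d_comp, torusPow_add,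
      Circle.coe_mul]
    rw [mul_comm]
  star_mul_self p := by
    rw [torusPow_vertex, one_smul, star_smul, smul_mul_assoc, mul_smul_comm, smul_smul,
      star_torusPow_mul_self, one_smul, T.star_mul_self]
  sum_range v n := by
    rw [torusPow_vertex, one_smul, T.sum_range v n]
    refine Finset.sum_congr rfl fun p _ => ?_
    rw [star_smul, smul_mul_assoc, mul_smul_comm, smul_smul, mul_comm, star_torusPow_mul_self,
      one_smul]

/-- Twisting all families by `z`. -/
noncomputable def CKRep.twist {Λ : KGraph k V} [Λ.IsFinite] (z : Fin k → Circle) (i : CKRep Λ) :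
    CKRep Λ where
  B := i.B
  inst := i.inst
  fam := i.fam.twist z

/-- The *-endomorphism of the product which permutes the coordinates by twisting. -/
noncomputable def bigGauge (Λ : KGraph k V) [Λ.IsFinite] (z : Fin k → Circle) :
    BigProd Λ →⋆ₙₐ[ℂ] BigProd Λ where
  toFun a := ⟨fun i => a (i.twist z), memℓp_infty (by
    obtain ⟨c, hc⟩ := memℓp_infty_iff.1 (lp.memℓp a)
    exact ⟨c, by rintro _ ⟨i, rfl⟩; exact hc ⟨i.twist z, rfl⟩⟩)⟩
  map_smul' _ _ := rfl
  map_zero' := rfl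
  map_add' _ _ := rfl
  map_mul' _ _ := rfl
  map_star' _ := rfl

theorem bigGauge_apply (Λ : KGraph k V) [Λ.IsFinite] (z : Fin k → Circle) (a : BigProd Λ)
    (i : CKRep Λ) : Λ.bigGauge z a i = a (i.twist z) := rfl

theorem bigGauge_bigGen (Λ : KGraph k V) [Λ.IsFinite] (z : Fin k → Circle) (p : Λ.Path) :
    Λ.bigGauge z (Λ.bigGen p) = (torusPow z (Λ.degree p) : ℂ) • Λ.bigGen p := rfl

theorem continuous_bigGauge (Λ : KGraph k V) [Λ.IsFinite] (z : Fin k → Circle) :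
    Continuous (Λ.bigGauge z) := by
  refine AddMonoidHomClass.continuous_of_bound (Λ.bigGauge z) 1 fun a => ?_
  rw [one_mul]
  exact lp.norm_le_of_forall_le (norm_nonneg a) fun i =>
    lp.norm_apply_le_norm ENNReal.top_ne_zero a (i.twist z)

theorem bigGauge_mem (Λ : KGraph k V) [Λ.IsFinite] (z : Fin k → Circle) {a : BigProd Λ}
    (ha : a ∈ Λ.cstarSubalgebra) : Λ.bigGauge z a ∈ Λ.cstarSubalgebra := by
  have h : Λ.cstarSubalgebra ≤ NonUnitalStarSubalgebra.comap (Λ.bigGauge z) Λ.cstarSubalgebra := by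
    refine NonUnitalStarSubalgebra.topologicalClosure_minimal _ ?_
      (Λ.isClosed_cstarSubalgebra.preimage (Λ.continuous_bigGauge z))
    refine NonUnitalStarAlgebra.adjoin_le ?_
    rintro _ ⟨p, rfl⟩
    change Λ.bigGauge z (Λ.bigGen p) ∈ Λ.cstarSubalgebra
    rw [bigGauge_bigGen]
    exact SMulMemClass.smul_mem _ (Λ.bigGen_mem p)
  exact h ha

theorem CKFamily.twist_twist {Λ : KGraph k V} [Λ.IsFinite] {B : Type*}
    [NonUnitalCStarAlgebra B] (T : CKFamily Λ B) (z w : Fin k → Circle) :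
    (T.twist z).twist w = T.twist (z * w) := by
  simp only [CKFamily.twist, CKFamily.mk.injEq]
  funext p
  rw [smul_smul, torusPow_mul, Circle.coe_mul, mul_comm]

theorem CKFamily.twist_one {Λ : KGraph k V} [Λ.IsFinite] {B : Type*}
    [NonUnitalCStarAlgebra B] (T : CKFamily Λ B) : T.twist 1 = T := by
  obtain ⟨t, _⟩ := T
  simp only [CKFamily.twist, CKFamily.mk.injEq]
  funext p
  rw [torusPow_one, Circle.coe_one, one_smul]

theorem bigGauge_bigGauge (Λ : KGraph k V) [Λ.IsFinite] (z w : Fin k → Circle) (a : BigProd Λ) :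
    Λ.bigGauge z (Λ.bigGauge w a) = Λ.bigGauge (z * w) a := by
  refine lp.ext (funext fun i => ?_)
  have key : ∀ f g : CKFamily Λ i.B, f = g →
      (a (CKRep.mk i.B f) : i.B) = a (CKRep.mk i.B g) := by
    rintro f _ rfl; rfl
  exact key _ _ (i.fam.twist_twist z w)

theorem bigGauge_one (Λ : KGraph k V) [Λ.IsFinite] (a : BigProd Λ) : Λ.bigGauge 1 a = a := by
  refine lp.ext (funext fun i => ?_)
  have key : ∀ f g : CKFamily Λ i.B, f = g →
      (a (CKRep.mk i.B f) : i.B) = a (CKRep.mk i.B g) := by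
    rintro f _ rfl; rfl
  exact key _ _ i.fam.twist_one

/-- The automorphism `γ_z` of `C*(Λ)`. -/
noncomputable def gaugeAut (Λ : KGraph k V) [Λ.IsFinite] (z : Fin k → Circle) :
    Λ.CStar ≃⋆ₐ[ℂ] Λ.CStar where
  toFun a := ⟨Λ.bigGauge z a, Λ.bigGauge_mem z a.2⟩
  invFun a := ⟨Λ.bigGauge z⁻¹ a, Λ.bigGauge_mem z⁻¹ a.2⟩
  left_inv a := Subtype.ext (by
    change Λ.bigGauge z⁻¹ (Λ.bigGauge z a) = a
    rw [bigGauge_bigGauge, inv_mul_cancel, bigGauge_one])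
  right_inv a := Subtype.ext (by
    change Λ.bigGauge z (Λ.bigGauge z⁻¹ a) = a
    rw [bigGauge_bigGauge, mul_inv_cancel, bigGauge_one])
  map_smul' _ _ := rfl
  map_add' _ _ := rfl
  map_mul' _ _ := rfl
  map_star' _ := rfl

/-- The gauge action `γ` of the `k`-torus on `C*(Λ)`. -/
noncomputable def gauge (Λ : KGraph k V) [Λ.IsFinite] :
    (Fin k → Circle) →* (Λ.CStar ≃⋆ₐ[ℂ] Λ.CStar) where
  toFun := Λ.gaugeAut
  map_one' := StarAlgEquiv.ext fun a => Subtype.ext (Λ.bigGauge_one a)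
  map_mul' z w := StarAlgEquiv.ext fun a => Subtype.ext (Λ.bigGauge_bigGauge z w a).symm

/-- The gauge action is characterised by `γ_z(s_p) = z^{d(p)} s_p`. -/
theorem gauge_gen (Λ : KGraph k V) [Λ.IsFinite] (z : Fin k → Circle) (p : Λ.Path) :
    Λ.gauge z (Λ.gen p) = (torusPow z (Λ.degree p) : ℂ) • Λ.gen p := rfl

/-- The dynamics `α_t = γ_{C^{it}}` on `C*(Λ)`, where `C^{it} = (C_1^{it}, …, C_k^{it})` and
`c^{it} = exp (i t log c)` for `c > 0`. -/
noncomputable def dynamics (Λ : KGraph k V) [Λ.IsFinite] (C : Fin k → ℝ) (t : ℝ) :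
    Λ.CStar ≃⋆ₐ[ℂ] Λ.CStar :=
  Λ.gauge fun i => Circle.exp (t * Real.log (C i))

end KGraph

/-! ### States and the KMS condition -/

/-- A state of a C*-algebra: a positive linear functional of norm one. -/
def IsCStarState {A : Type*} [NonUnitalCStarAlgebra A] (φ : A →L[ℂ] ℂ) : Prop :=
  (∀ a : A, 0 ≤ (φ (star a * a)).re ∧ (φ (star a * a)).im = 0) ∧ ‖φ‖ = 1

/-- `F` is an entire function extending `t ↦ α_t(a)`. -/
def IsEntireExtension {A : Type*} [NonUnitalCStarAlgebra A] (α : ℝ → (A ≃⋆ₐ[ℂ] A)) (a : A)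
    (F : ℂ → A) : Prop :=
  Differentiable ℂ F ∧ ∀ t : ℝ, F t = α t a

/-- `φ` is a KMS state at inverse temperature `β` for the dynamics `α`: it is a state, and
`φ(ab) = φ(b α_{iβ}(a))` for all analytic elements `a`, `b`. -/
def IsKMSState {A : Type*} [NonUnitalCStarAlgebra A] (α : ℝ → (A ≃⋆ₐ[ℂ] A)) (β : ℝ)
    (φ : A →L[ℂ] ℂ) : Prop :=
  IsCStarState φ ∧
    ∀ (a b : A) (F G : ℂ → A), IsEntireExtension α a F → IsEntireExtension α b G →
      φ (a * b) = φ (b * F (Complex.I * β))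

/-! ### Semibranching function systems -/

/-- `Φ` is a Radon-Nikodym derivative `d(μ ∘ σ)/dμ` on `D`, where `μ ∘ σ` is the set function
`E ↦ μ (σ(E))` on the measurable subsets `E` of `D`. -/
def IsRNDerivOn {X : Type*} [MeasurableSpace X] (μ : Measure X) (D : Set X) (σ : X → X)
    (Φ : X → ℝ≥0∞) : Prop :=
  AEMeasurable Φ (μ.restrict D) ∧
    ∀ E : Set X, MeasurableSet E → E ⊆ D → μ (σ '' E) = ∫⁻ x in E, Φ x ∂μ

/-- A finite family of maps `σ_i : D_i → X` is a semibranching function system on `(X, μ)`.  Only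
the values of `σ i` on `D i` matter. -/
structure IsSemibranching {X : Type*} [MeasurableSpace X] (μ : Measure X) {ι : Type*}
    (D : ι → Set X) (σ : ι → X → X) : Prop where
  finite_index : Finite ι
  measurable_domain : ∀ i, MeasurableSet (D i)
  measurable_map : ∀ i, Measurable ((D i).domRestrict (σ i))
  measurable_range : ∀ i, NullMeasurableSet (σ i '' D i) μ
  cover : μ (⋃ i, σ i '' D i)ᶜ = 0
  disjoint : ∀ i j, i ≠ j → μ (σ i '' D i ∩ σ j '' D j) = 0
  rnDeriv : ∀ i, ∃ Φ : X → ℝ≥0∞, IsRNDerivOn μ (D i) (σ i) Φ ∧ ∀ᵐ x ∂μ.restrict (D i), 0 < Φ x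

/-- `c` is a coding map for the family `σ_i : D_i → X`. -/
def IsCodingMap {X : Type*} [MeasurableSpace X] {ι : Type*} (D : ι → Set X) (σ : ι → X → X)
    (c : X → X) : Prop :=
  Measurable c ∧ ∀ i, ∀ x ∈ D i, c (σ i x) = x

/-- A `Λ`-semibranching function system on `(X, μ)`, with prefixing maps `τ_p : D_p → X` (only the
values of `τ p` on `D p` matter) and coding maps `τ^m`, here `code m`. -/
structure KGraph.SemibranchingSystem {k : ℕ} {V : Type u} [SmallCategory V] (Λ : KGraph k V)
    {X : Type*} [MeasurableSpace X] (μ : Measure X) where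
  D : Λ.Path → Set X
  τ : Λ.Path → X → X
  code : (Fin k → ℕ) → X → X
  semibranching : ∀ m : Fin k → ℕ,
    IsSemibranching μ (fun p : {p : Λ.Path // Λ.degree p = m} => D p) (fun p => τ p)
  coding : ∀ m : Fin k → ℕ,
    IsCodingMap (fun p : {p : Λ.Path // Λ.degree p = m} => D p) (fun p => τ p) (code m)
  vertex_id : ∀ v : V, ∀ x ∈ D (Λ.vertex v), τ (Λ.vertex v) x = x
  vertex_pos : ∀ v : V, 0 < μ (D (Λ.vertex v))
  range_subset : ∀ {u w v : V} (lam : w ⟶ v) (ν : u ⟶ w),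
    τ ⟨ν⟩ '' D ⟨ν⟩ ≤ᵐ[μ] D ⟨lam⟩
  /- The partial maps `τ_lam ∘ τ_ν`, defined almost everywhere on `D_ν`, and `τ_{lam ν}` agree almost
  everywhere: their domains agree up to a null set, and so do their values. -/
  domain_comp : ∀ {u w v : V} (lam : w ⟶ v) (ν : u ⟶ w), D ⟨ν ≫ lam⟩ =ᵐ[μ] D ⟨ν⟩
  comp : ∀ {u w v : V} (lam : w ⟶ v) (ν : u ⟶ w),
    ∀ᵐ x ∂μ, x ∈ D ⟨ν⟩ → τ ⟨lam⟩ (τ ⟨ν⟩ x) = τ ⟨ν ≫ lam⟩ x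
  code_comp : ∀ m n : Fin k → ℕ, code m ∘ code n = code (m + n)

/-- The range `R_p = τ_p(D_p)`. -/
def KGraph.SemibranchingSystem.R {k : ℕ} {V : Type u} [SmallCategory V] {Λ : KGraph k V}
    {X : Type*} [MeasurableSpace X] {μ : Measure X} (S : Λ.SemibranchingSystem μ)
    (p : Λ.Path) : Set X :=
  S.τ p '' S.D p

/-!
Fix for each path `e` an infinite path extending `e`. An infinite path `x` gives a vector state on
`C*(Λ)`, by letting `Λ` act by prefixing on the Hilbert space of infinite paths graded by `ℤ^k`:
its value at `s_p s_q^*` is `1` if `p = q` is an initial segment of `x`, and `0` otherwise, the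
grading being what kills the terms with `p ≠ q`. The measures `μ(R_p)` are additive under extension
of paths, so the convex combinations of these states over `e ∈ Λ^n`, with weights `μ(R_e)`, take the
value `δ_{p,q} μ(R_p)` at `s_p s_q^*` as soon as `n ≥ d(p)`, and a weak-* limit point `φ` is a state
with the required values. It is unique since the monomials `s_p s_q^*` span a dense subspace.

For the KMS condition it suffices to take `b = s_p s_q^*`, an eigenvector of the dynamics: then
`e^{itθ} φ(b α_t(a)) = φ(α_t(ba)) = φ(ba)` for real `t`, hence for all complex `t`. At `t = iω` the
exponential is the factor in `φ(ba) = C^{-ω(d(p) - d(q))} φ(ab)`, which holds because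
`μ(R_{pq}) = C^{-ωd(p)} μ(R_q)`.
-/

namespace KGraph

variable {k : ℕ} {V : Type u} [SmallCategory V]

/-! ### Concatenation of paths -/

open scoped Classical in
/-- The concatenation `pq` of two paths, defined to be `p` when the source of `p` is not the range
of `q`. -/
noncomputable def Path.append {Λ : KGraph k V} (p q : Λ.Path) : Λ.Path :=
  if h : q.r = p.s then ⟨q.hom ≫ eqToHom h ≫ p.hom⟩ else p

namespace Path

variable {Λ : KGraph k V}

theorem append_mk {u w v : V} (μ : w ⟶ v) (ν : u ⟶ w) :
    append (⟨μ⟩ : Λ.Path) ⟨ν⟩ = ⟨ν ≫ μ⟩ := by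
  simp [append]

theorem append_s {p q : Λ.Path} (h : q.r = p.s) : (p.append q).s = q.s := by
  simp [append, h]

theorem append_r {p q : Λ.Path} (h : q.r = p.s) : (p.append q).r = p.r := by
  simp [append, h]

theorem degree_append {p q : Λ.Path} (h : q.r = p.s) :
    Λ.degree (p.append q) = Λ.degree p + Λ.degree q := by
  obtain ⟨f⟩ := p
  obtain ⟨g⟩ := q
  obtain rfl : _ = _ := h
  rw [append_mk]
  exact Λ.d_comp g f

theorem append_assoc {p q e : Λ.Path} (h : q.r = p.s) (h' : e.r = q.s) :
    (p.append q).append e = p.append (q.append e) := by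
  obtain ⟨f⟩ := p
  obtain ⟨g⟩ := q
  obtain ⟨l⟩ := e
  obtain rfl : _ = _ := h
  obtain rfl : _ = _ := h'
  simp only [append_mk, Category.assoc]

theorem vertex_append {p : Λ.Path} {v : V} (h : p.r = v) : (Λ.vertex v).append p = p := by
  obtain ⟨f⟩ := p
  obtain rfl : _ = _ := h
  simp [vertex, append_mk]

theorem append_vertex {p : Λ.Path} {v : V} (h : p.s = v) : p.append (Λ.vertex v) = p := by
  obtain ⟨f⟩ := p
  obtain rfl : _ = _ := h
  simp [vertex, append_mk]

theorem degree_vertex (v : V) : Λ.degree (Λ.vertex v) = 0 := Λ.d_id v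

theorem vertex_injective : Function.Injective Λ.vertex := fun _ _ h => congrArg Path.r h

theorem exists_eq_append {p : Λ.Path} {m n : Fin k → ℕ} (h : Λ.degree p = m + n) :
    ∃ a b : Λ.Path, b.r = a.s ∧ a.append b = p ∧ Λ.degree a = m ∧ Λ.degree b = n := by
  obtain ⟨f⟩ := p
  obtain ⟨⟨w, g, l⟩, ⟨hgl, hl, hg⟩, -⟩ := Λ.factorization f m n h
  exact ⟨⟨l⟩, ⟨g⟩, rfl, by rw [append_mk, hgl], hl, hg⟩

theorem append_inj {a b a' b' : Λ.Path} (h : b.r = a.s) (h' : b'.r = a'.s)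
    (hd : Λ.degree a = Λ.degree a') (heq : a.append b = a'.append b') : a = a' ∧ b = b' := by
  have hd' : Λ.degree b = Λ.degree b' := by
    have := congrArg Λ.degree heq
    rw [degree_append h, degree_append h', hd] at this
    exact add_left_cancel this
  obtain ⟨f⟩ := a
  obtain ⟨g⟩ := b
  obtain ⟨f'⟩ := a'
  obtain ⟨g'⟩ := b'
  obtain rfl : _ = _ := h
  obtain rfl : _ = _ := h'
  rw [append_mk, append_mk, Path.mk.injEq] at heq
  obtain ⟨rfl, rfl, heq⟩ := heq
  have hunique := (Λ.factorization (g ≫ f) (Λ.d f) (Λ.d g) (Λ.d_comp g f)).unique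
    (y₁ := ⟨_, g, f⟩) (y₂ := ⟨_, g', f'⟩) ⟨rfl, rfl, rfl⟩
    ⟨(eq_of_heq heq).symm, hd.symm, hd'.symm⟩
  obtain ⟨rfl, hpair⟩ := Sigma.mk.inj hunique
  obtain ⟨rfl, rfl⟩ := Prod.mk.inj (eq_of_heq hpair)
  exact ⟨rfl, rfl⟩

theorem append_left_cancel {p a b : Λ.Path} (ha : a.r = p.s) (hb : b.r = p.s)
    (h : p.append a = p.append b) : a = b :=
  (append_inj ha hb rfl h).2

/-! ### The prefix order -/

/-- The prefix order on paths: `p ≤ q` if `q = pe` for some path `e`. -/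
instance : PartialOrder Λ.Path where
  le p q := ∃ e : Λ.Path, e.r = p.s ∧ p.append e = q
  le_refl p := ⟨Λ.vertex p.s, rfl, append_vertex rfl⟩
  le_trans := by
    rintro p _ _ ⟨e, he, rfl⟩ ⟨f, hf, rfl⟩
    rw [append_s he] at hf
    exact ⟨e.append f, (append_r hf).trans he, (append_assoc he hf).symm⟩
  le_antisymm := by
    rintro p _ ⟨e, he, rfl⟩ ⟨f, hf, hpef⟩
    have hd : Λ.degree (p.append e) = Λ.degree p := by
      have := congrArg Λ.degree hpef
      rw [degree_append hf, degree_append he, add_assoc, add_eq_left, add_eq_zero] at this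
      rw [degree_append he, this.1, add_zero]
    exact (append_inj hf rfl hd (hpef.trans (append_vertex rfl).symm)).1.symm

theorem le_append {p e : Λ.Path} (h : e.r = p.s) : p ≤ p.append e := ⟨e, h, rfl⟩

theorem r_eq_of_le {p q : Λ.Path} (h : p ≤ q) : p.r = q.r := by
  obtain ⟨e, he, rfl⟩ := h
  exact (append_r he).symm

theorem degree_mono : Monotone Λ.degree := by
  rintro p _ ⟨e, he, rfl⟩
  rw [degree_append he]
  exact le_self_add

theorem vertex_le (p : Λ.Path) : Λ.vertex p.r ≤ p := ⟨p, rfl, vertex_append rfl⟩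

theorem exists_le_degree_eq {q : Λ.Path} {m : Fin k → ℕ} (h : m ≤ Λ.degree q) :
    ∃ p ≤ q, Λ.degree p = m := by
  obtain ⟨a, b, hba, rfl, hda, -⟩ := exists_eq_append (add_tsub_cancel_of_le h).symm
  exact ⟨a, le_append hba, hda⟩

theorem eq_of_le_of_le {p q e : Λ.Path} (hp : p ≤ e) (hq : q ≤ e)
    (hd : Λ.degree p = Λ.degree q) : p = q := by
  obtain ⟨a, ha, hpa⟩ := hp
  obtain ⟨b, hb, hqb⟩ := hq
  exact (append_inj ha hb hd (hpa.trans hqb.symm)).1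

theorem le_of_degree_le {p q e : Λ.Path} (hp : p ≤ e) (hq : q ≤ e)
    (hd : Λ.degree p ≤ Λ.degree q) : p ≤ q := by
  obtain ⟨p', hp', hdp'⟩ := exists_le_degree_eq hd
  rwa [eq_of_le_of_le hp (hp'.trans hq) hdp'.symm]

theorem append_le_append_iff {p a b : Λ.Path} (ha : a.r = p.s) (hb : b.r = p.s) :
    p.append a ≤ p.append b ↔ a ≤ b := by
  constructor
  · rintro ⟨e, he, heq⟩
    rw [append_s ha] at he
    rw [append_assoc ha he] at heq
    exact ⟨e, he, append_left_cancel ((append_r he).trans ha) hb heq⟩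
  · rintro ⟨e, he, rfl⟩
    exact ⟨e, he.trans (append_s ha).symm, append_assoc ha he⟩

theorem eq_vertex_of_degree_eq_zero {p : Λ.Path} (h : Λ.degree p = 0) : p = Λ.vertex p.r :=
  eq_of_le_of_le le_rfl p.vertex_le (h.trans (degree_vertex _).symm)

/-- The path `e` with `q = pe`, for a prefix `p` of `q`. -/
noncomputable def suffix {p q : Λ.Path} (h : p ≤ q) : Λ.Path := h.choose

theorem suffix_r {p q : Λ.Path} (h : p ≤ q) : (suffix h).r = p.s := h.choose_spec.1

theorem append_suffix {p q : Λ.Path} (h : p ≤ q) : p.append (suffix h) = q := h.choose_spec.2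

end Path

/-! ### Infinite paths -/

/-- An infinite path of a `k`-graph, given by its compatible initial segments of all degrees; this
is the same as a degree-preserving functor to `Λ` from the `k`-graph `Ω_k` of pairs `m ≤ n`
in `ℕ^k`. -/
@[ext]
structure InfPath (Λ : KGraph k V) where
  seg : (Fin k → ℕ) → Λ.Path
  degree_seg : ∀ n, Λ.degree (seg n) = n
  monotone_seg : Monotone seg

namespace InfPath

variable {Λ : KGraph k V}

/-- The range of an infinite path. -/
def r (x : Λ.InfPath) : V := (x.seg 0).r

theorem seg_r (x : Λ.InfPath) (n : Fin k → ℕ) : (x.seg n).r = x.r :=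
  (Path.r_eq_of_le (x.monotone_seg zero_le)).symm

theorem seg_zero (x : Λ.InfPath) : x.seg 0 = Λ.vertex x.r :=
  Path.eq_vertex_of_degree_eq_zero (x.degree_seg 0)

theorem seg_eq_of_le {x : Λ.InfPath} {p : Λ.Path} {n : Fin k → ℕ} (h : p ≤ x.seg n) :
    x.seg (Λ.degree p) = p := by
  have hd : Λ.degree p ≤ n := (Path.degree_mono h).trans_eq (x.degree_seg n)
  exact Path.eq_of_le_of_le (x.monotone_seg hd) h (x.degree_seg _)

theorem seg_degree_eq_iff_le {x : Λ.InfPath} {p q : Λ.Path} (hq : x.seg (Λ.degree q) = q)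
    (hd : Λ.degree p ≤ Λ.degree q) : x.seg (Λ.degree p) = p ↔ p ≤ q := by
  constructor <;> intro hp
  · simpa only [hp, hq] using x.monotone_seg hd
  · exact seg_eq_of_le (hp.trans_eq hq.symm)

theorem ext_seg_add {x y : Λ.InfPath} (n : Fin k → ℕ)
    (h : ∀ m, x.seg (n + m) = y.seg (n + m)) : x = y := by
  refine InfPath.ext (funext fun m => ?_)
  have hx : x.seg m ≤ x.seg (n + m) := x.monotone_seg le_add_self
  have hy : y.seg m ≤ x.seg (n + m) := (y.monotone_seg le_add_self).trans_eq (h m).symm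
  exact Path.eq_of_le_of_le hx hy ((x.degree_seg m).trans (y.degree_seg m).symm)

/-- The limit of an increasing family of finite paths of unbounded degree. -/
noncomputable def ofMonotone (P : (Fin k → ℕ) → Λ.Path) (hP : Monotone P)
    (hd : ∀ n, n ≤ Λ.degree (P n)) : Λ.InfPath where
  seg n := (Path.exists_le_degree_eq (hd n)).choose
  degree_seg n := (Path.exists_le_degree_eq (hd n)).choose_spec.2
  monotone_seg m n hmn := by
    obtain ⟨hm, hdm⟩ := (Path.exists_le_degree_eq (hd m)).choose_spec
    obtain ⟨hn, hdn⟩ := (Path.exists_le_degree_eq (hd n)).choose_spec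
    exact Path.le_of_degree_le (hm.trans (hP hmn)) hn (by rwa [hdm, hdn])

theorem seg_ofMonotone {P : (Fin k → ℕ) → Λ.Path} {hP : Monotone P}
    {hd : ∀ n, n ≤ Λ.degree (P n)} {p : Λ.Path} {n : Fin k → ℕ} (h : p ≤ P n) :
    (ofMonotone P hP hd).seg (Λ.degree p) = p := by
  have hseg : (ofMonotone P hP hd).seg (Λ.degree p) ≤ P (Λ.degree p) :=
    (Path.exists_le_degree_eq (hd _)).choose_spec.1
  exact Path.eq_of_le_of_le (hseg.trans (hP le_sup_right)) (h.trans (hP le_sup_left))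
    ((ofMonotone P hP hd).degree_seg _)

/-- The infinite path `px`. -/
noncomputable def cons (p : Λ.Path) (x : Λ.InfPath) (h : x.r = p.s) : Λ.InfPath :=
  ofMonotone (fun n => p.append (x.seg n))
    (fun m n hmn => (Path.append_le_append_iff ((x.seg_r m).trans h) ((x.seg_r n).trans h)).2
      (x.monotone_seg hmn))
    (fun n => by
      rw [Path.degree_append ((x.seg_r n).trans h), x.degree_seg]
      exact le_add_self)

theorem seg_cons {p : Λ.Path} {x : Λ.InfPath} (h : x.r = p.s) (n : Fin k → ℕ) :
    (cons p x h).seg (Λ.degree p + n) = p.append (x.seg n) := by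
  have hseg : (cons p x h).seg (Λ.degree (p.append (x.seg n))) = p.append (x.seg n) :=
    seg_ofMonotone (n := n) le_rfl
  rwa [Path.degree_append ((x.seg_r n).trans h), x.degree_seg] at hseg

theorem seg_cons_degree {p : Λ.Path} {x : Λ.InfPath} (h : x.r = p.s) :
    (cons p x h).seg (Λ.degree p) = p := by
  simpa only [add_zero, x.seg_zero, Path.append_vertex h.symm] using seg_cons h 0

theorem cons_r {p : Λ.Path} {x : Λ.InfPath} (h : x.r = p.s) : (cons p x h).r = p.r := by
  rw [← seg_r _ (Λ.degree p), seg_cons_degree]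

theorem cons_vertex {v : V} {x : Λ.InfPath} (h : x.r = (Λ.vertex v).s) :
    cons (Λ.vertex v) x h = x := by
  refine ext_seg_add (Λ.degree (Λ.vertex v)) fun m => ?_
  rw [seg_cons, Path.vertex_append (v := v) ((x.seg_r m).trans h), Path.degree_vertex, zero_add]

theorem cons_append {p q : Λ.Path} {x : Λ.InfPath} (h : q.r = p.s) (hx : x.r = q.s) :
    cons (p.append q) x (hx.trans (Path.append_s h).symm) =
      cons p (cons q x hx) ((cons_r hx).trans h) := by
  refine ext_seg_add (Λ.degree p + Λ.degree q) fun m => ?_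
  rw [add_assoc, seg_cons, seg_cons, ← add_assoc, ← Path.degree_append h, seg_cons,
    Path.append_assoc h ((x.seg_r m).trans hx)]

/-- The tail of an infinite path after its initial segment of degree `n`. -/
noncomputable def shift (n : Fin k → ℕ) (x : Λ.InfPath) : Λ.InfPath where
  seg m := Path.suffix (x.monotone_seg (le_self_add : n ≤ n + m))
  degree_seg m := by
    have h := Path.degree_append (Path.suffix_r (x.monotone_seg (le_self_add : n ≤ n + m)))
    rw [Path.append_suffix, x.degree_seg, x.degree_seg] at h
    exact (add_left_cancel h).symm
  monotone_seg m m' hm := by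
    refine (Path.append_le_append_iff (p := x.seg n) (Path.suffix_r _) (Path.suffix_r _)).1 ?_
    simpa only [Path.append_suffix] using x.monotone_seg (add_le_add_right hm n)

theorem append_seg_shift (n m : Fin k → ℕ) (x : Λ.InfPath) :
    (x.seg n).append ((x.shift n).seg m) = x.seg (n + m) :=
  Path.append_suffix _

theorem shift_r (n : Fin k → ℕ) (x : Λ.InfPath) : (x.shift n).r = (x.seg n).s :=
  Path.suffix_r _

theorem cons_seg_shift (n : Fin k → ℕ) (x : Λ.InfPath) :
    cons (x.seg n) (x.shift n) (x.shift_r n) = x := by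
  refine ext_seg_add (Λ.degree (x.seg n)) fun m => ?_
  rw [seg_cons, append_seg_shift, x.degree_seg]

theorem shift_cons {p : Λ.Path} {x : Λ.InfPath} (h : x.r = p.s) :
    (cons p x h).shift (Λ.degree p) = x := by
  refine InfPath.ext (funext fun m => ?_)
  have hr : ((cons p x h).shift (Λ.degree p)).r = p.s := by rw [shift_r, seg_cons_degree]
  refine Path.append_left_cancel ((seg_r _ m).trans hr) ((x.seg_r m).trans h) ?_
  rw [← seg_cons h, ← append_seg_shift, seg_cons_degree]

theorem exists_seg_degree_eq (hΛ : Λ.NoSources) (p : Λ.Path) :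
    ∃ x : Λ.InfPath, x.seg (Λ.degree p) = p := by
  have hext (q : Λ.Path) : ∃ e, q ≤ e ∧ Λ.degree e = Λ.degree q + 1 := by
    obtain ⟨f, hf, hdf⟩ := hΛ q.s 1
    exact ⟨q.append f, Path.le_append hf, by rw [Path.degree_append hf, hdf]⟩
  choose next le_next degree_next using hext
  have hchain : Monotone fun j => next^[j] p := monotone_nat_of_le_succ fun j => by
    rw [Function.iterate_succ_apply']
    exact le_next _
  have hdegree (j : ℕ) : (fun _ => j) ≤ Λ.degree (next^[j] p) := by
    induction j with
    | zero => exact fun _ => Nat.zero_le _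
    | succ j ih =>
      rw [Function.iterate_succ_apply', degree_next]
      exact fun i => Nat.succ_le_succ (ih i)
  let P (n : Fin k → ℕ) : Λ.Path := next^[∑ i, n i] p
  have hP : Monotone P := fun m n hmn => hchain (Finset.sum_le_sum fun i _ => hmn i)
  have hdP (n : Fin k → ℕ) : n ≤ Λ.degree (P n) := fun i =>
    (Finset.single_le_sum (fun _ _ => Nat.zero_le _) (Finset.mem_univ i)).trans (hdegree _ i)
  exact ⟨ofMonotone P hP hdP, seg_ofMonotone (n := 0) (hchain (Nat.zero_le _))⟩

end InfPath

end KGraph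

/-! ### Operators on `ℓ²` induced by partial bijections -/

section PEquivPullback

open scoped InnerProductSpace

variable {𝕜 Z W U : Type*} [RCLike 𝕜]

theorem sum_pequiv_elim (f : Z ≃. W) (g : W → ℝ) (s : Finset Z) :
    ∑ z ∈ s, (f z).elim 0 g = ∑ w ∈ s.filterMap f fun _ _ _ => f.inj, g w := by
  refine Finset.sum_bij_ne_zero
    (fun z _ hz => (f z).get (Option.isSome_iff_ne_none.2 fun hfz => hz (by simp [hfz])))
    (fun z hzs hz => ?_) (fun z _ hz z' _ hz' hzz' => ?_) (fun w hw hgw => ?_) (fun z _ hz => ?_)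
  · exact (Finset.mem_filterMap _).2 ⟨z, hzs, by simp⟩
  · exact f.inj (Option.get_mem _) (Option.mem_def.2 (by rw [hzz', Option.some_get]))
  · obtain ⟨z, hzs, hzw⟩ := (Finset.mem_filterMap _).1 hw
    exact ⟨z, hzs, by simpa [hzw] using hgw, by simp [hzw]⟩
  · obtain ⟨w, hw⟩ : ∃ w, f z = some w :=
      Option.ne_none_iff_exists'.1 fun hfz => hz (by simp [hfz])
    simp [hw]

theorem sum_norm_rpow_pequiv_elim_le (f : Z ≃. W) (g : lp (fun _ : W => 𝕜) 2) (s : Finset Z) :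
    ∑ z ∈ s, ‖(f z).elim 0 g‖ ^ (2 : ℝ≥0∞).toReal ≤ ‖g‖ ^ (2 : ℝ≥0∞).toReal := by
  have helim (z : Z) : ‖(f z).elim 0 g‖ ^ (2 : ℝ≥0∞).toReal =
      (f z).elim 0 fun w => ‖g w‖ ^ (2 : ℝ≥0∞).toReal := by
    cases f z <;> simp
  simp only [helim, sum_pequiv_elim]
  exact lp.sum_rpow_le_norm_rpow (by simp) g _

/-- The partial isometry `g ↦ g ∘ f` between `ℓ²`-spaces given by a partial bijection `f`, where
`g ∘ f` is extended by zero outside the domain of `f`. -/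
noncomputable def pequivPullback (f : Z ≃. W) :
    lp (fun _ : W => 𝕜) 2 →L[𝕜] lp (fun _ : Z => 𝕜) 2 :=
  LinearMap.mkContinuous
    { toFun g := ⟨fun z => (f z).elim 0 g, memℓp_gen' (sum_norm_rpow_pequiv_elim_le f g)⟩
      map_add' g g' := by
        ext z
        change (f z).elim 0 _ = (f z).elim 0 g + (f z).elim 0 g'
        cases f z
        · exact (add_zero _).symm
        · rfl
      map_smul' c g := by
        ext z
        change (f z).elim 0 _ = c * (f z).elim 0 g
        cases f z
        · exact (mul_zero _).symm
        · rfl } 1 fun g => by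
    rw [one_mul]
    exact lp.norm_le_of_forall_sum_le (by simp) (norm_nonneg g) (sum_norm_rpow_pequiv_elim_le f g)

theorem pequivPullback_apply (f : Z ≃. W) (g : lp (fun _ : W => 𝕜) 2) (z : Z) :
    pequivPullback f g z = (f z).elim 0 g := rfl

theorem pequivPullback_single [DecidableEq Z] [DecidableEq W] (f : Z ≃. W) (w : W) (c : 𝕜) :
    pequivPullback f (lp.single 2 w c) = (f.symm w).elim 0 fun z => lp.single 2 z c := by
  ext z
  rw [pequivPullback_apply]
  cases hw : f.symm w with
  | none =>
    have hz : f z ≠ some w := fun hz => by simp [f.eq_some_iff.2 hz] at hw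
    cases hfz : f z with
    | none => simp
    | some w' => simp [show w' ≠ w by simpa [hfz] using hz]
  | some z' =>
    have hz' : f z' = some w := f.eq_some_iff.1 hw
    by_cases hzz' : z = z'
    · simp [hzz', hz']
    · cases hfz : f z with
      | none => simp [hzz']
      | some w' => simp [hzz', show w' ≠ w by rintro rfl; exact hzz' (f.inj hfz hz')]

theorem pequivPullback_trans (f : Z ≃. W) (g : W ≃. U) :
    pequivPullback (𝕜 := 𝕜) (f.trans g) = pequivPullback f ∘L pequivPullback g := by
  ext h z
  change ((f z).bind g).elim 0 h = (f z).elim 0 fun w => (g w).elim 0 h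
  cases f z <;> rfl

theorem pequivPullback_ofSet_apply (s : Set Z) [DecidablePred (· ∈ s)]
    (g : lp (fun _ : Z => 𝕜) 2) (z : Z) :
    pequivPullback (PEquiv.ofSet s) g z = if z ∈ s then g z else 0 := by
  change (if z ∈ s then some z else none).elim 0 g = _
  split_ifs <;> rfl

theorem adjoint_pequivPullback (f : Z ≃. W) :
    ContinuousLinearMap.adjoint (pequivPullback (𝕜 := 𝕜) f) = pequivPullback f.symm := by
  classical
  ext h w
  have hinner := ContinuousLinearMap.adjoint_inner_right (pequivPullback f)
    (lp.single 2 w (1 : 𝕜)) h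
  rw [pequivPullback_single, lp.inner_single_left] at hinner
  rw [pequivPullback_apply]
  cases hw : f.symm w <;> simpa [hw, lp.inner_single_left] using hinner

theorem star_pequivPullback (f : Z ≃. Z) :
    star (pequivPullback (𝕜 := 𝕜) f) = pequivPullback f.symm :=
  adjoint_pequivPullback f

theorem pequivPullback_mul_pequivPullback (f g : Z ≃. Z) :
    pequivPullback (𝕜 := 𝕜) f * pequivPullback g = pequivPullback (f.trans g) :=
  (pequivPullback_trans f g).symm

theorem pequivPullback_mul_star_mul_self (f : Z ≃. Z) :
    pequivPullback (𝕜 := 𝕜) f * star (pequivPullback f) * pequivPullback f =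
      pequivPullback f := by
  rw [star_pequivPullback, pequivPullback_mul_pequivPullback, pequivPullback_mul_pequivPullback]
  congr 1
  ext z w
  simp only [PEquiv.trans_eq_some, PEquiv.eq_some_iff]
  exact ⟨fun ⟨z', ⟨w', hz, hz'⟩, hw⟩ => by rwa [f.inj hz hz'], fun h => ⟨z, ⟨w, h, h⟩, h⟩⟩

theorem isStarProjection_pequivPullback_ofSet (s : Set Z) [DecidablePred (· ∈ s)] :
    IsStarProjection (pequivPullback (𝕜 := 𝕜) (PEquiv.ofSet s)) where
  isIdempotentElem := by
    ext g z
    rw [mul_apply_eq_comp]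
    simp only [pequivPullback_ofSet_apply]
    split_ifs <;> rfl
  isSelfAdjoint := by rw [IsSelfAdjoint, star_pequivPullback, PEquiv.ofSet_symm]

theorem pequivPullback_ofSet_mul_pequivPullback_ofSet {s t : Set Z} [DecidablePred (· ∈ s)]
    [DecidablePred (· ∈ t)] (h : Disjoint s t) :
    pequivPullback (𝕜 := 𝕜) (PEquiv.ofSet s) * pequivPullback (PEquiv.ofSet t) = 0 := by
  ext g z
  rw [mul_apply_eq_comp]
  simp only [pequivPullback_ofSet_apply]
  split_ifs with hs ht
  · exact (Set.disjoint_left.1 h hs ht).elim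
  · rfl
  · rfl

theorem sum_pequivPullback_ofSet_fiber {ι : Type*} [DecidableEq ι] (f : Z → ι) (s : Finset ι) :
    ∑ i ∈ s, pequivPullback (𝕜 := 𝕜) (PEquiv.ofSet {z | f z = i}) =
      pequivPullback (PEquiv.ofSet {z | f z ∈ s}) := by
  ext g z
  rw [sum_apply, lp.coeFn_sum, Finset.sum_apply]
  simp only [pequivPullback_ofSet_apply, Set.mem_ofPred_eq, Finset.sum_ite_eq]

theorem inner_single_pequivPullback_single [DecidableEq Z] (f : Z ≃. Z) (z : Z) :
    ⟪lp.single 2 z (1 : 𝕜), pequivPullback f (lp.single 2 z 1)⟫_𝕜 =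
      if f z = some z then 1 else 0 := by
  rw [lp.inner_single_left, pequivPullback_apply]
  cases hfz : f z with
  | none => simp
  | some w => by_cases hw : w = z <;> simp [hw]

end PEquivPullback

namespace KGraph

open scoped InnerProductSpace

variable {k : ℕ} {V : Type u} [SmallCategory V] {Λ : KGraph k V}

/-! ### The graded infinite path representation -/

/-- The degree of a path as an element of `ℤ^k`. -/
def intDegree (p : Λ.Path) : Fin k → ℤ := fun i => Λ.degree p i

theorem intDegree_append {p q : Λ.Path} (h : q.r = p.s) :
    intDegree (p.append q) = intDegree p + intDegree q := by
  funext i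
  simp [intDegree, Path.degree_append h]

theorem intDegree_inj {p q : Λ.Path} :
    intDegree p = intDegree q ↔ Λ.degree p = Λ.degree q := by
  simp [intDegree, funext_iff]

open scoped Classical in
/-- The partial bijection `(x, m) ↦ (px, m + d(p))` of infinite paths carrying a `ℤ^k`-valued
degree, defined when the range of `x` is the source of `p`.  The second coordinate makes
the partial bijections `px ↦ qx` with `d(p) ≠ d(q)` fixed point free, even on periodic paths. -/
noncomputable def gradedCons (p : Λ.Path) :
    Λ.InfPath × (Fin k → ℤ) ≃. Λ.InfPath × (Fin k → ℤ) where
  toFun z := if h : z.1.r = p.s then some (InfPath.cons p z.1 h, z.2 + intDegree p) else none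
  invFun z := if z.1.seg (Λ.degree p) = p then
    some (z.1.shift (Λ.degree p), z.2 - intDegree p) else none
  inv := by
    rintro ⟨x, m⟩ ⟨y, n⟩
    simp only [Option.dite_none_right_eq_some, Option.ite_none_right_eq_some,
      Option.some.injEq, Prod.mk.injEq]
    constructor
    · rintro ⟨hy, rfl, rfl⟩
      refine ⟨(y.shift_r _).trans (congrArg Path.s hy), ?_, sub_add_cancel _ _⟩
      conv_rhs => rw [← y.cons_seg_shift (Λ.degree p)]
      simp only [hy]
    · rintro ⟨hx, rfl, rfl⟩
      exact ⟨InfPath.seg_cons_degree hx, InfPath.shift_cons hx, add_sub_cancel_right _ _⟩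

theorem gradedCons_eq_some_iff {p : Λ.Path} {x y : Λ.InfPath} {m n : Fin k → ℤ} :
    gradedCons p (x, m) = some (y, n) ↔
      (∃ h : x.r = p.s, InfPath.cons p x h = y) ∧ m + intDegree p = n := by
  classical
  change (if h : x.r = p.s then some (InfPath.cons p x h, m + intDegree p) else none) = _ ↔ _
  simp only [Option.dite_none_right_eq_some, Option.some.injEq, Prod.mk.injEq, exists_and_right]

theorem isSome_gradedCons_iff {p : Λ.Path} {z : Λ.InfPath × (Fin k → ℤ)} :
    (gradedCons p z).isSome ↔ z.1.r = p.s := by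
  classical
  change (if h : z.1.r = p.s then some (InfPath.cons p z.1 h, z.2 + intDegree p)
    else none).isSome ↔ _
  split_ifs with h <;> simp [h]

theorem isSome_gradedCons_symm_iff {p : Λ.Path} {z : Λ.InfPath × (Fin k → ℤ)} :
    ((gradedCons p).symm z).isSome ↔ z.1.seg (Λ.degree p) = p := by
  classical
  change (if z.1.seg (Λ.degree p) = p then
    some (z.1.shift (Λ.degree p), z.2 - intDegree p) else none).isSome ↔ _
  split_ifs with h <;> simp [h]

theorem gradedCons_append {p q : Λ.Path} (h : q.r = p.s) :
    gradedCons (p.append q) = (gradedCons q).trans (gradedCons p) := by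
  refine PEquiv.ext fun ⟨x, m⟩ => Option.ext fun ⟨y, n⟩ => ?_
  simp only [PEquiv.trans_eq_some, gradedCons_eq_some_iff, Prod.exists, intDegree_append h,
    Path.append_s h]
  constructor
  · rintro ⟨⟨hx, rfl⟩, rfl⟩
    exact ⟨_, _, ⟨⟨hx, rfl⟩, rfl⟩, ⟨(InfPath.cons_r hx).trans h, (InfPath.cons_append h hx).symm⟩,
      by abel⟩
  · rintro ⟨_, _, ⟨⟨hx, rfl⟩, rfl⟩, ⟨-, rfl⟩, rfl⟩
    exact ⟨⟨hx, InfPath.cons_append h hx⟩, by abel⟩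

open scoped Classical in
theorem gradedCons_vertex (v : V) :
    gradedCons (Λ.vertex v) = PEquiv.ofSet {z : Λ.InfPath × (Fin k → ℤ) | z.1.r = v} := by
  have hd : intDegree (Λ.vertex v) = 0 := funext fun i => by simp [intDegree, Path.degree_vertex]
  refine PEquiv.ext fun ⟨x, m⟩ => Option.ext fun ⟨y, n⟩ => ?_
  rw [gradedCons_eq_some_iff, PEquiv.ofSet_eq_some_iff, hd, add_zero, Set.mem_ofPred_eq,
    Prod.mk.injEq]
  constructor
  · rintro ⟨⟨hx, rfl⟩, rfl⟩
    exact ⟨⟨InfPath.cons_vertex hx, rfl⟩, (congrArg InfPath.r (InfPath.cons_vertex hx)).trans hx⟩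
  · rintro ⟨⟨rfl, rfl⟩, hx⟩
    exact ⟨⟨hx, InfPath.cons_vertex hx⟩, rfl⟩

theorem gradedCons_trans_symm (p : Λ.Path) :
    (gradedCons p).trans (gradedCons p).symm = gradedCons (Λ.vertex p.s) := by
  classical
  rw [PEquiv.self_trans_symm, gradedCons_vertex]
  congr! 3
  exact isSome_gradedCons_iff

theorem gradedCons_symm_trans_eq_some_iff {p q : Λ.Path} {z : Λ.InfPath × (Fin k → ℤ)} :
    ((gradedCons p).symm.trans (gradedCons q)) z = some z ↔
      p = q ∧ z.1.seg (Λ.degree p) = p := by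
  obtain ⟨y, n⟩ := z
  simp only [PEquiv.trans_eq_some, PEquiv.eq_some_iff, Prod.exists, gradedCons_eq_some_iff]
  constructor
  · rintro ⟨x, m, ⟨⟨hp, rfl⟩, rfl⟩, ⟨hq, hqp⟩, hd⟩
    have hd : Λ.degree q = Λ.degree p := intDegree_inj.1 (add_left_cancel hd)
    refine ⟨?_, InfPath.seg_cons_degree hp⟩
    rw [← InfPath.seg_cons_degree hp, ← hqp, ← hd, InfPath.seg_cons_degree hq]
  · rintro ⟨rfl, hy⟩
    obtain ⟨⟨x, m⟩, hx⟩ := Option.isSome_iff_exists.1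
      (isSome_gradedCons_symm_iff (z := (y, n)) |>.2 hy)
    have hx := gradedCons_eq_some_iff.1 ((gradedCons p).eq_some_iff.1 hx)
    exact ⟨x, m, hx, hx⟩

open scoped Classical in
theorem gradedCons_symm_trans_self (p : Λ.Path) :
    (gradedCons p).symm.trans (gradedCons p) =
      PEquiv.ofSet {z : Λ.InfPath × (Fin k → ℤ) | z.1.seg (Λ.degree p) = p} := by
  rw [PEquiv.symm_trans_self]
  congr! 3
  exact isSome_gradedCons_symm_iff

variable (Λ) in
/-- The Hilbert space with orthonormal basis the infinite paths carrying a `ℤ^k`-valued degree. -/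
abbrev GradedSpace : Type u := lp (fun _ : Λ.InfPath × (Fin k → ℤ) => ℂ) 2

variable [Λ.IsFinite]

variable (Λ) in
/-- The Cuntz-Krieger `Λ`-family of isometries prepending finite paths to infinite paths, on the
Hilbert space `ℓ²` of the set of infinite paths with a `ℤ^k`-valued degree. -/
noncomputable def gradedFamily :
    CKFamily Λ (GradedSpace Λ →L[ℂ] GradedSpace Λ) where
  t p := pequivPullback (gradedCons p).symm
  partialIsometry p := pequivPullback_mul_star_mul_self _
  vertex_proj v := by
    classical
    rw [gradedCons_vertex, PEquiv.ofSet_symm]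
    exact isStarProjection_pequivPullback_ofSet _
  vertex_orthogonal v w h := by
    classical
    simp only [gradedCons_vertex, PEquiv.ofSet_symm]
    exact pequivPullback_ofSet_mul_pequivPullback_ofSet
      (Set.disjoint_left.2 fun z hv hw => h (hv.symm.trans hw))
  mul μ ν := by
    rw [pequivPullback_mul_pequivPullback, ← PEquiv.symm_trans_rev, ← gradedCons_append rfl,
      Path.append_mk]
  star_mul_self p := by
    classical
    rw [star_pequivPullback, PEquiv.symm_symm, pequivPullback_mul_pequivPullback,
      gradedCons_trans_symm, gradedCons_vertex, PEquiv.ofSet_symm]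
  sum_range v n := by
    classical
    have hproj : ∀ p ∈ Λ.into v n, pequivPullback (𝕜 := ℂ) (gradedCons p).symm *
        star (pequivPullback (gradedCons p).symm) =
          pequivPullback (PEquiv.ofSet {z | z.1.seg n = p}) := by
      intro p hp
      obtain ⟨-, rfl⟩ := (Λ.mem_into v n p).1 hp
      rw [star_pequivPullback, PEquiv.symm_symm, pequivPullback_mul_pequivPullback,
        gradedCons_symm_trans_self]
    rw [Finset.sum_congr rfl hproj, sum_pequivPullback_ofSet_fiber, gradedCons_vertex,
      PEquiv.ofSet_symm]
    simp only [mem_into, InfPath.seg_r, InfPath.degree_seg, and_true]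

variable (Λ) in
/-- The representation of `C*(Λ)` on graded infinite paths. -/
noncomputable def gradedHom : Λ.CStar →⋆ₙₐ[ℂ] (GradedSpace Λ →L[ℂ] GradedSpace Λ) :=
  Λ.lift ⟨_, gradedFamily Λ⟩

open scoped Classical in
theorem inner_single_gradedFamily (p q : Λ.Path) (z : Λ.InfPath × (Fin k → ℤ)) :
    ⟪(lp.single 2 z 1 : GradedSpace Λ), ((gradedFamily Λ).t p * star ((gradedFamily Λ).t q))
      (lp.single 2 z 1)⟫_ℂ = if p = q ∧ z.1.seg (Λ.degree p) = p then 1 else 0 := by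
  have hstar : star ((gradedFamily Λ).t q) = pequivPullback (gradedCons q) :=
    star_pequivPullback _
  have hmul : (gradedFamily Λ).t p * star ((gradedFamily Λ).t q) =
      pequivPullback ((gradedCons p).symm.trans (gradedCons q)) := by
    rw [hstar]
    exact pequivPullback_mul_pequivPullback _ _
  rw [hmul, inner_single_pequivPullback_single]
  simp only [gradedCons_symm_trans_eq_some_iff]

end KGraph

/-! ### Relations in a Cuntz-Krieger family -/

namespace KGraph

variable {k : ℕ} {V : Type u} [SmallCategory V] {Λ : KGraph k V} [Λ.IsFinite]

namespace CKFamily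

variable {B : Type*} [NonUnitalCStarAlgebra B] (T : CKFamily Λ B)

theorem t_append {p q : Λ.Path} (h : q.r = p.s) : T.t (p.append q) = T.t p * T.t q := by
  obtain ⟨f⟩ := p
  obtain ⟨g⟩ := q
  obtain rfl : _ = _ := h
  rw [Path.append_mk, T.mul]

theorem mul_vertex (p : Λ.Path) : T.t p * T.t (Λ.vertex p.s) = T.t p := by
  rw [← T.t_append rfl, Path.append_vertex rfl]

theorem vertex_mul (p : Λ.Path) : T.t (Λ.vertex p.r) * T.t p = T.t p := by
  rw [← T.t_append rfl, Path.vertex_append rfl]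

theorem star_vertex (v : V) : star (T.t (Λ.vertex v)) = T.t (Λ.vertex v) :=
  (T.vertex_proj v).isSelfAdjoint

theorem mul_eq_zero {p q : Λ.Path} (h : q.r ≠ p.s) : T.t p * T.t q = 0 := by
  rw [← T.mul_vertex p, ← T.vertex_mul q, mul_assoc, ← mul_assoc (T.t (Λ.vertex p.s)),
    T.vertex_orthogonal _ _ h.symm, zero_mul, mul_zero]

theorem mul_star_eq_zero {p q : Λ.Path} (h : p.s ≠ q.s) : T.t p * star (T.t q) = 0 := by
  rw [← T.mul_vertex p, ← T.mul_vertex q, star_mul, T.star_vertex, mul_assoc,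
    ← mul_assoc (T.t (Λ.vertex p.s)), T.vertex_orthogonal _ _ h, zero_mul, mul_zero]

theorem star_mul_eq_zero_of_r_ne {p q : Λ.Path} (h : p.r ≠ q.r) : star (T.t p) * T.t q = 0 := by
  rw [← T.vertex_mul p, ← T.vertex_mul q, star_mul, T.star_vertex, mul_assoc,
    ← mul_assoc (T.t (Λ.vertex p.r)), T.vertex_orthogonal _ _ h, zero_mul, mul_zero]

theorem sum_erase_star_mul_mul_star_mul [DecidableEq Λ.Path] (p : Λ.Path) :
    ∑ e ∈ (Λ.into p.r (Λ.degree p)).erase p, star (T.t p) * (T.t e * star (T.t e)) * T.t p = 0 := by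
  have hp : p ∈ Λ.into p.r (Λ.degree p) := (Λ.mem_into _ _ _).2 ⟨rfl, rfl⟩
  have hsum : ∑ e ∈ Λ.into p.r (Λ.degree p), star (T.t p) * (T.t e * star (T.t e)) * T.t p =
      star (T.t p) * T.t p := by
    rw [← Finset.sum_mul, ← Finset.mul_sum, ← T.sum_range, mul_assoc, T.vertex_mul]
  rwa [← Finset.add_sum_erase _ _ hp, mul_assoc, T.partialIsometry, add_eq_left] at hsum

theorem star_mul_eq_zero {p q : Λ.Path} (hd : Λ.degree p = Λ.degree q) (h : p ≠ q) :
    star (T.t p) * T.t q = 0 := by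
  classical
  obtain hr | hr := ne_or_eq p.r q.r
  · exact T.star_mul_eq_zero_of_r_ne hr
  -- The positive elements `(t_e^* t_q)^* (t_e^* t_q)` with `e ≠ q` sum to zero, so each is zero.
  let _ := CStarAlgebra.spectralOrder B
  let _ := CStarAlgebra.spectralOrderedRing B
  have hp : p ∈ (Λ.into q.r (Λ.degree q)).erase q :=
    Finset.mem_erase.2 ⟨h, (Λ.mem_into _ _ _).2 ⟨hr, hd⟩⟩
  have hsum : ∑ e ∈ (Λ.into q.r (Λ.degree q)).erase q,
      star (star (T.t e) * T.t q) * (star (T.t e) * T.t q) = 0 := by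
    simpa only [star_mul, star_star, mul_assoc] using T.sum_erase_star_mul_mul_star_mul q
  have hzero := (Finset.sum_eq_zero_iff_of_nonneg fun e _ => star_mul_self_nonneg _).1 hsum p hp
  exact (CStarRing.star_mul_self_eq_zero_iff _).1 hzero

theorem star_append_mul {p e : Λ.Path} (h : e.r = p.s) :
    star (T.t (p.append e)) * T.t p = star (T.t e) := by
  rw [T.t_append h, star_mul, mul_assoc, T.star_mul_self, ← h, ← T.star_vertex, ← star_mul,
    T.vertex_mul]

theorem star_mul_eq_zero_of_not_le {p q : Λ.Path} (hd : Λ.degree p ≤ Λ.degree q)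
    (h : ¬p ≤ q) : star (T.t q) * T.t p = 0 := by
  obtain ⟨a, ⟨b, hb, rfl⟩, ha⟩ := Path.exists_le_degree_eq hd
  have hap : a ≠ p := fun hap => h (hap ▸ Path.le_append hb)
  rw [T.t_append hb, star_mul, mul_assoc, T.star_mul_eq_zero ha hap, mul_zero]

theorem mul_star_eq_sum {p q : Λ.Path} (h : p.s = q.s) (n : Fin k → ℕ) :
    T.t p * star (T.t q) =
      ∑ e ∈ Λ.into p.s n, T.t (p.append e) * star (T.t (q.append e)) := by
  rw [← T.mul_vertex p, T.sum_range _ n, Finset.mul_sum, Finset.sum_mul]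
  refine Finset.sum_congr rfl fun e he => ?_
  have he := ((Λ.mem_into _ _ _).1 he).1
  rw [T.t_append he, T.t_append (he.trans h), star_mul, ← mul_assoc, ← mul_assoc]

/-- The linear span of the monomials `t_p t_q^*` of a Cuntz-Krieger family. -/
def monomialSpan : Submodule ℂ B :=
  Submodule.span ℂ (Set.range fun x : Λ.Path × Λ.Path => T.t x.1 * star (T.t x.2))

variable {T}

theorem mul_star_mem_monomialSpan (p q : Λ.Path) : T.t p * star (T.t q) ∈ T.monomialSpan :=
  Submodule.subset_span ⟨(p, q), rfl⟩

theorem t_mem_monomialSpan (p : Λ.Path) : T.t p ∈ T.monomialSpan := by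
  rw [← T.mul_vertex p, ← T.star_vertex]
  exact mul_star_mem_monomialSpan p _

theorem star_mem_monomialSpan {a : B} (ha : a ∈ T.monomialSpan) : star a ∈ T.monomialSpan := by
  induction ha using Submodule.span_induction with
  | mem x hx =>
    obtain ⟨⟨p, q⟩, rfl⟩ := hx
    rw [star_mul, star_star]
    exact mul_star_mem_monomialSpan q p
  | zero => rw [star_zero]; exact zero_mem _
  | add x y _ _ hx hy => rw [star_add]; exact add_mem hx hy
  | smul c x _ hx => rw [star_smul]; exact Submodule.smul_mem _ _ hx

theorem mul_star_mul_star_mem_monomialSpan (p q f : Λ.Path) :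
    T.t p * star (T.t q) * star (T.t f) ∈ T.monomialSpan := by
  rw [mul_assoc, ← star_mul]
  obtain h | h := eq_or_ne q.r f.s
  · rw [← T.t_append h]
    exact mul_star_mem_monomialSpan _ _
  · rw [T.mul_eq_zero h, star_zero, mul_zero]
    exact zero_mem _

theorem mul_star_mul_mul_star_mem_monomialSpan (p q e f : Λ.Path) :
    T.t p * star (T.t q) * (T.t e * star (T.t f)) ∈ T.monomialSpan := by
  obtain h | h := ne_or_eq p.s q.s
  · rw [T.mul_star_eq_zero h, zero_mul]
    exact zero_mem _
  rw [T.mul_star_eq_sum h (Λ.degree e), Finset.sum_mul]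
  refine sum_mem fun g hg => ?_
  obtain ⟨hgr, hgd⟩ := (Λ.mem_into _ _ _).1 hg
  rw [← mul_assoc, mul_assoc (T.t _)]
  by_cases heg : e ≤ q.append g
  · obtain ⟨b, hb, heb⟩ := heg
    rw [← heb, T.star_append_mul hb]
    exact mul_star_mul_star_mem_monomialSpan _ _ _
  · have hd : Λ.degree e ≤ Λ.degree (q.append g) := by
      rw [Path.degree_append (hgr.trans h), hgd]
      exact le_add_self
    rw [T.star_mul_eq_zero_of_not_le hd heg, mul_zero, zero_mul]
    exact zero_mem _

theorem mul_mem_monomialSpan {a b : B} (ha : a ∈ T.monomialSpan) (hb : b ∈ T.monomialSpan) :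
    a * b ∈ T.monomialSpan := by
  induction ha, hb using Submodule.span_induction₂ with
  | mem_mem x y hx hy =>
    obtain ⟨⟨p, q⟩, rfl⟩ := hx
    obtain ⟨⟨e, f⟩, rfl⟩ := hy
    exact mul_star_mul_mul_star_mem_monomialSpan p q e f
  | zero_left y _ => rw [zero_mul]; exact zero_mem _
  | zero_right x _ => rw [mul_zero]; exact zero_mem _
  | add_left x y z _ _ _ hx hy => rw [add_mul]; exact add_mem hx hy
  | add_right x y z _ _ _ hx hy => rw [mul_add]; exact add_mem hx hy
  | smul_left c x y _ _ h => rw [smul_mul_assoc]; exact Submodule.smul_mem _ _ h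
  | smul_right c x y _ _ h => rw [mul_smul_comm]; exact Submodule.smul_mem _ _ h

variable (T) in
/-- The span of the monomials `t_p t_q^*` as a *-subalgebra. -/
def monomialSubalgebra : NonUnitalStarSubalgebra ℂ B where
  __ := T.monomialSpan
  mul_mem' := mul_mem_monomialSpan
  star_mem' := star_mem_monomialSpan

theorem clm_ext {R E : Type*} [Semiring R] {σ : ℂ →+* R} [AddCommMonoid E] [Module R E]
    [TopologicalSpace E] [T2Space E] (hT : Dense (T.monomialSpan : Set B)) {φ ψ : B →SL[σ] E}
    (h : ∀ p q, φ (T.t p * star (T.t q)) = ψ (T.t p * star (T.t q))) : φ = ψ := by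
  refine ContinuousLinearMap.ext_on hT ?_
  rintro _ ⟨⟨p, q⟩, rfl⟩
  exact h p q

end CKFamily

variable (Λ) in
theorem dense_monomialSpan : Dense (Λ.genFamily.monomialSpan : Set Λ.CStar) := fun a => by
  have hadjoin : NonUnitalStarAlgebra.adjoin ℂ (Set.range Λ.bigGen) ≤
      Λ.genFamily.monomialSubalgebra.map
        (NonUnitalStarSubalgebraClass.subtype Λ.cstarSubalgebra) := by
    refine NonUnitalStarAlgebra.adjoin_le ?_
    rintro _ ⟨p, rfl⟩
    exact ⟨Λ.gen p, CKFamily.t_mem_monomialSpan p, rfl⟩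
  rw [closure_subtype]
  exact closure_mono hadjoin a.2

end KGraph

/-! ### Positive functionals -/

section PositiveFunctional

variable {A : Type*} [NonUnitalCStarAlgebra A]

/-- Positivity of a functional on a C*-algebra, phrased without the partial order of `ℂ`; a state
is a positive functional of norm one. -/
def IsPositiveFunctional (φ : A →L[ℂ] ℂ) : Prop :=
  ∀ a : A, 0 ≤ (φ (star a * a)).re ∧ (φ (star a * a)).im = 0

theorem IsPositiveFunctional.sum_smul {ι : Type*} {s : Finset ι} {c : ι → ℝ}
    {φ : ι → A →L[ℂ] ℂ} (hc : ∀ i ∈ s, 0 ≤ c i) (hφ : ∀ i ∈ s, IsPositiveFunctional (φ i)) :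
    IsPositiveFunctional (∑ i ∈ s, (c i : ℂ) • φ i) := by
  intro a
  simp only [sum_apply, smul_apply, smul_eq_mul, Complex.re_sum, Complex.im_sum,
    Complex.re_ofReal_mul, Complex.im_ofReal_mul]
  exact ⟨Finset.sum_nonneg fun i hi => mul_nonneg (hc i hi) (hφ i hi a).1,
    Finset.sum_eq_zero fun i hi => by rw [(hφ i hi a).2, mul_zero]⟩

theorem IsPositiveFunctional.of_tendsto {ι : Type*} {l : Filter ι} [l.NeBot]
    {φ : ι → A →L[ℂ] ℂ} {ψ : A →L[ℂ] ℂ} (hφ : ∀ i, IsPositiveFunctional (φ i))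
    (h : ∀ a, Filter.Tendsto (fun i => φ i a) l (nhds (ψ a))) : IsPositiveFunctional ψ := by
  intro a
  have hre := (Complex.continuous_re.tendsto _).comp (h (star a * a))
  have him := (Complex.continuous_im.tendsto _).comp (h (star a * a))
  exact ⟨ge_of_tendsto' hre fun i => (hφ i a).1,
    tendsto_nhds_unique him (tendsto_const_nhds.congr fun i => (hφ i a).2.symm)⟩

variable {H : Type*} [NormedAddCommGroup H] [InnerProductSpace ℂ H] [CompleteSpace H]

open scoped InnerProductSpace

/-- The functional `a ↦ ⟪ξ, π(a) ξ⟫` of a vector `ξ` in a representation `π`. -/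
noncomputable def vectorFunctional (π : A →⋆ₙₐ[ℂ] (H →L[ℂ] H)) (ξ : H) : A →L[ℂ] ℂ :=
  LinearMap.mkContinuous
    { toFun a := ⟪ξ, π a ξ⟫_ℂ
      map_add' a b := by rw [map_add, add_apply, inner_add_right]
      map_smul' c a := by rw [map_smul, smul_apply, inner_smul_right]; rfl } (‖ξ‖ ^ 2) fun a => by
    calc ‖⟪ξ, π a ξ⟫_ℂ‖ ≤ ‖ξ‖ * ‖π a ξ‖ := norm_inner_le_norm _ _
      _ ≤ ‖ξ‖ * (‖a‖ * ‖ξ‖) := by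
        gcongr
        exact (π a).le_of_opNorm_le (NonUnitalStarAlgHom.norm_apply_le π a) ξ
      _ = ‖ξ‖ ^ 2 * ‖a‖ := by ring

theorem vectorFunctional_apply (π : A →⋆ₙₐ[ℂ] (H →L[ℂ] H)) (ξ : H) (a : A) :
    vectorFunctional π ξ a = ⟪ξ, π a ξ⟫_ℂ := rfl

theorem norm_vectorFunctional_le (π : A →⋆ₙₐ[ℂ] (H →L[ℂ] H)) (ξ : H) :
    ‖vectorFunctional π ξ‖ ≤ ‖ξ‖ ^ 2 :=
  LinearMap.mkContinuous_norm_le _ (sq_nonneg _) _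

theorem isPositiveFunctional_vectorFunctional (π : A →⋆ₙₐ[ℂ] (H →L[ℂ] H)) (ξ : H) :
    IsPositiveFunctional (vectorFunctional π ξ) := by
  intro a
  have hnorm : vectorFunctional π ξ (star a * a) = ((‖π a ξ‖ ^ 2 : ℝ) : ℂ) := by
    rw [vectorFunctional_apply, map_mul, map_star, mul_apply_eq_comp,
      ContinuousLinearMap.star_eq_adjoint, ContinuousLinearMap.adjoint_inner_right,
      inner_self_eq_norm_sq_to_K]
    norm_cast
  rw [hnorm]
  exact ⟨sq_nonneg _, Complex.ofReal_im _⟩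

end PositiveFunctional

theorem exists_ultrafilter_tendsto_of_opNorm_le {𝕜 E ι : Type*} [NontriviallyNormedField 𝕜]
    [ProperSpace 𝕜] [SeminormedAddCommGroup E] [NormedSpace 𝕜 E] (l : Filter ι) [l.NeBot]
    {F : ι → E →L[𝕜] 𝕜} {c : ℝ} (hF : ∀ i, ‖F i‖ ≤ c) :
    ∃ u : Ultrafilter ι, ↑u ≤ l ∧ ∃ φ : E →L[𝕜] 𝕜, ‖φ‖ ≤ c ∧
      ∀ a, Filter.Tendsto (fun i => F i a) u (nhds (φ a)) := by
  let G : ι → WeakDual 𝕜 E := fun i => StrongDual.toWeakDual (F i)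
  have hmem : WeakDual.toStrongDual ⁻¹' Metric.closedBall 0 c ∈ (Ultrafilter.of l).map G :=
    Filter.mem_map.2 (Filter.univ_mem' fun i => by simpa [G] using hF i)
  obtain ⟨φ, hφ, htendsto⟩ := (WeakDual.isCompact_closedBall (0 : StrongDual 𝕜 E) c)
    |>.ultrafilter_le_nhds' _ hmem
  exact ⟨Ultrafilter.of l, Ultrafilter.of_le l, WeakDual.toStrongDual φ,
    mem_closedBall_zero_iff.1 hφ, fun a => ((WeakDual.eval_continuous a).tendsto φ).comp htendsto⟩

namespace KGraph

/-! ### Functionals from weights on paths -/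

variable {k : ℕ} {V : Type u} [SmallCategory V] {Λ : KGraph k V} [Λ.IsFinite]

variable (Λ) in
/-- The finite set `Λ^n` of paths of degree `n`. -/
noncomputable def ofDegree (n : Fin k → ℕ) : Finset Λ.Path :=
  (IsFinite.finite_degree n).toFinset

theorem mem_ofDegree {n : Fin k → ℕ} {p : Λ.Path} : p ∈ Λ.ofDegree n ↔ Λ.degree p = n := by
  simp [ofDegree]

/-- A probability weight on the paths of `Λ`; it plays the role of the measures `p ↦ ν(Z(p))` of
the cylinder sets for a probability measure `ν` on the space of infinite paths. -/
structure IsProbabilityWeight (w : Λ.Path → ℝ) : Prop where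
  nonneg : ∀ p, 0 ≤ w p
  eq_sum_append : ∀ p n, w p = ∑ e ∈ Λ.into p.s n, w (p.append e)
  sum_ofDegree : ∀ n, ∑ p ∈ Λ.ofDegree n, w p = 1

open scoped Classical in
/-- A functional `φ` is diagonal with weight `w` for a Cuntz-Krieger family `t` if
`φ(t_p t_q^*) = δ_{p,q} w(p)`. -/
def CKFamily.IsDiagonal {B : Type*} [NonUnitalCStarAlgebra B] (T : CKFamily Λ B) (φ : B →L[ℂ] ℂ)
    (w : Λ.Path → ℝ) : Prop :=
  ∀ p q, φ (T.t p * star (T.t q)) = if p = q then (w p : ℂ) else 0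

open scoped Classical in
theorem sum_filter_le_ofDegree {M : Type*} [AddCommMonoid M] (w : Λ.Path → M) {p : Λ.Path}
    {n : Fin k → ℕ} (h : Λ.degree p ≤ n) :
    ∑ q ∈ Λ.ofDegree n with p ≤ q, w q = ∑ e ∈ Λ.into p.s (n - Λ.degree p), w (p.append e) := by
  symm
  refine Finset.sum_bij (fun e _ => p.append e) (fun e he => ?_) (fun e he f hf => ?_)
    (fun q hq => ?_) fun _ _ => rfl
  · obtain ⟨her, hed⟩ := (Λ.mem_into _ _ _).1 he
    refine Finset.mem_filter.2 ⟨mem_ofDegree.2 ?_, Path.le_append her⟩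
    rw [Path.degree_append her, hed, add_tsub_cancel_of_le h]
  · exact Path.append_left_cancel ((Λ.mem_into _ _ _).1 he).1 ((Λ.mem_into _ _ _).1 hf).1
  · obtain ⟨hqn, e, he, rfl⟩ := Finset.mem_filter.1 hq
    refine ⟨e, (Λ.mem_into _ _ _).2 ⟨he, ?_⟩, rfl⟩
    rw [← mem_ofDegree.1 hqn, Path.degree_append he, add_tsub_cancel_left]

open scoped Classical in
theorem IsProbabilityWeight.sum_filter_le {w : Λ.Path → ℝ} (hw : IsProbabilityWeight w)
    {p : Λ.Path} {n : Fin k → ℕ} (h : Λ.degree p ≤ n) :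
    ∑ q ∈ Λ.ofDegree n with p ≤ q, w q = w p := by
  rw [sum_filter_le_ofDegree w h, ← hw.eq_sum_append]

open scoped Classical in
/-- The vector functional on `C*(Λ)` of an infinite path. -/
noncomputable def InfPath.functional (x : Λ.InfPath) : Λ.CStar →L[ℂ] ℂ :=
  vectorFunctional (gradedHom Λ) (lp.single 2 (x, 0) 1)

theorem InfPath.norm_functional_le (x : Λ.InfPath) : ‖x.functional‖ ≤ 1 := by
  classical
  refine (norm_vectorFunctional_le _ _).trans_eq ?_
  rw [lp.norm_single (by norm_num), norm_one, one_pow]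

theorem InfPath.isPositiveFunctional_functional (x : Λ.InfPath) :
    IsPositiveFunctional x.functional :=
  isPositiveFunctional_vectorFunctional _ _

open scoped Classical in
theorem InfPath.functional_gen_mul_star_gen (x : Λ.InfPath) (p q : Λ.Path) :
    x.functional (Λ.gen p * star (Λ.gen q)) =
      if p = q ∧ x.seg (Λ.degree p) = p then 1 else 0 := by
  rw [functional, vectorFunctional_apply, map_mul, map_star]
  exact inner_single_gradedFamily p q (x, 0)

/-- The convex combination with weights `w e` of the functionals of chosen infinite paths `x e`,
where `e` runs through `Λ^n`.  For `x e` extending `e`, it is the `n`-th approximation to the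
functional with `φ(s_p s_q^*) = δ_{p,q} w(p)`. -/
noncomputable def approxFunctional (w : Λ.Path → ℝ) (x : Λ.Path → Λ.InfPath) (n : Fin k → ℕ) :
    Λ.CStar →L[ℂ] ℂ :=
  ∑ e ∈ Λ.ofDegree n, (w e : ℂ) • (x e).functional

namespace IsProbabilityWeight

variable {w : Λ.Path → ℝ}

theorem isPositiveFunctional_approxFunctional (hw : IsProbabilityWeight w)
    (x : Λ.Path → Λ.InfPath) (n : Fin k → ℕ) : IsPositiveFunctional (approxFunctional w x n) :=
  .sum_smul (fun e _ => hw.nonneg e) fun e _ => (x e).isPositiveFunctional_functional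

theorem norm_approxFunctional_le (hw : IsProbabilityWeight w) (x : Λ.Path → Λ.InfPath)
    (n : Fin k → ℕ) : ‖approxFunctional w x n‖ ≤ 1 := by
  refine ContinuousLinearMap.opNorm_le_bound _ zero_le_one fun a => ?_
  rw [approxFunctional, sum_apply, ← hw.sum_ofDegree n, Finset.sum_mul]
  refine norm_sum_le_of_le _ fun e _ => ?_
  rw [smul_apply, norm_smul, Complex.norm_of_nonneg (hw.nonneg e)]
  gcongr
  · exact hw.nonneg e
  · simpa only [one_mul] using (x e).functional.le_of_opNorm_le (x e).norm_functional_le a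

open scoped Classical in
theorem approxFunctional_gen_mul_star_gen (hw : IsProbabilityWeight w) {x : Λ.Path → Λ.InfPath}
    (hx : ∀ e, (x e).seg (Λ.degree e) = e) {p : Λ.Path} (q : Λ.Path) {n : Fin k → ℕ}
    (hn : Λ.degree p ≤ n) :
    approxFunctional w x n (Λ.gen p * star (Λ.gen q)) = if p = q then (w p : ℂ) else 0 := by
  have hseg : ∀ e ∈ Λ.ofDegree n, ((x e).seg (Λ.degree p) = p ↔ p ≤ e) := fun e he =>
    InfPath.seg_degree_eq_iff_le (hx e) (hn.trans_eq (mem_ofDegree.1 he).symm)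
  simp only [approxFunctional, sum_apply, smul_apply, InfPath.functional_gen_mul_star_gen]
  split_ifs with hpq
  · rw [← hw.sum_filter_le hn, Finset.sum_filter, Complex.ofReal_sum]
    refine Finset.sum_congr rfl fun e he => ?_
    simp only [hpq, true_and, hpq ▸ hseg e he, smul_eq_mul, mul_ite, mul_one, mul_zero,
      apply_ite Complex.ofReal, Complex.ofReal_zero]
  · simp only [hpq, false_and, if_false, smul_zero, Finset.sum_const_zero]

theorem exists_isDiagonal (hw : IsProbabilityWeight w) (hΛ : Λ.NoSources) :
    ∃ φ : Λ.CStar →L[ℂ] ℂ, ‖φ‖ ≤ 1 ∧ IsPositiveFunctional φ ∧ Λ.genFamily.IsDiagonal φ w := by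
  choose x hx using InfPath.exists_seg_degree_eq hΛ
  obtain ⟨u, hu, φ, hφ, htendsto⟩ := exists_ultrafilter_tendsto_of_opNorm_le Filter.atTop
    (hw.norm_approxFunctional_le x)
  refine ⟨φ, hφ, .of_tendsto (hw.isPositiveFunctional_approxFunctional x) htendsto,
    fun p q => tendsto_nhds_unique (htendsto _) (Filter.Tendsto.congr' ?_ tendsto_const_nhds)⟩
  filter_upwards [hu (Filter.eventually_ge_atTop (Λ.degree p))] with n hn
  exact (hw.approxFunctional_gen_mul_star_gen hx q hn).symm

end IsProbabilityWeight

end KGraph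

/-! ### Diagonal functionals -/

namespace KGraph

variable {k : ℕ} {V : Type u} [SmallCategory V] {Λ : KGraph k V} [Λ.IsFinite]

namespace CKFamily

variable {B : Type*} [NonUnitalCStarAlgebra B] {T : CKFamily Λ B}

variable (T) in
theorem norm_sum_ofDegree_le (n : Fin k → ℕ) :
    ‖∑ p ∈ Λ.ofDegree n, T.t p * star (T.t p)‖ ≤ 1 := by
  refine IsStarProjection.norm_le _ ⟨?_, ?_⟩
  · rw [IsIdempotentElem, Finset.sum_mul]
    refine Finset.sum_congr rfl fun p hp => ?_
    rw [Finset.mul_sum, Finset.sum_eq_single_of_mem p hp]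
    · rw [← mul_assoc, T.partialIsometry]
    · intro q hq hqp
      have hd : Λ.degree p = Λ.degree q := (mem_ofDegree.1 hp).trans (mem_ofDegree.1 hq).symm
      rw [mul_assoc, ← mul_assoc (star (T.t p)), T.star_mul_eq_zero hd hqp.symm, zero_mul,
        mul_zero]
  · simp only [IsSelfAdjoint, star_sum, star_mul, star_star]

namespace IsDiagonal

variable {φ ψ : B →L[ℂ] ℂ} {w : Λ.Path → ℝ}

theorem map_self (hφ : T.IsDiagonal φ w) (p : Λ.Path) : φ (T.t p * star (T.t p)) = w p := by
  rw [hφ, if_pos rfl]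

theorem map_of_ne (hφ : T.IsDiagonal φ w) {p q : Λ.Path} (h : p ≠ q) :
    φ (T.t p * star (T.t q)) = 0 := by
  rw [hφ, if_neg h]

theorem eq (hφ : T.IsDiagonal φ w) (hψ : T.IsDiagonal ψ w)
    (hT : Dense (T.monomialSpan : Set B)) : φ = ψ :=
  clm_ext hT fun p q => (hφ p q).trans (hψ p q).symm

theorem one_le_norm (hφ : T.IsDiagonal φ w) (hw : IsProbabilityWeight w) : 1 ≤ ‖φ‖ := by
  have hsum : φ (∑ p ∈ Λ.ofDegree 0, T.t p * star (T.t p)) = 1 := by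
    rw [map_sum, Finset.sum_congr rfl fun p _ => hφ.map_self p]
    exact_mod_cast hw.sum_ofDegree 0
  calc 1 = ‖φ (∑ p ∈ Λ.ofDegree 0, T.t p * star (T.t p))‖ := by rw [hsum, norm_one]
    _ ≤ ‖φ‖ * ‖∑ p ∈ Λ.ofDegree 0, T.t p * star (T.t p)‖ := φ.le_opNorm _
    _ ≤ ‖φ‖ := mul_le_of_le_one_right (norm_nonneg _) (T.norm_sum_ofDegree_le 0)

theorem map_star (hφ : T.IsDiagonal φ w) (hT : Dense (T.monomialSpan : Set B)) (a : B) :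
    φ (star a) = star (φ a) := by
  refine DFunLike.congr_fun (clm_ext hT (φ := φ.comp (starL ℂ : B ≃L⋆[ℂ] B).toContinuousLinearMap)
    (ψ := (starL ℂ : ℂ ≃L⋆[ℂ] ℂ).toContinuousLinearMap.comp φ) fun p q => ?_) a
  change φ (star (T.t p * star (T.t q))) = star (φ (T.t p * star (T.t q)))
  rw [star_mul, star_star]
  by_cases h : p = q
  · rw [h, hφ.map_self, RCLike.star_def, Complex.conj_ofReal]
  · rw [hφ.map_of_ne h, hφ.map_of_ne (Ne.symm h), star_zero]

variable {κ : ℝ}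

theorem map_t_mul_monomial_of_degree_le (hφ : T.IsDiagonal φ w) {p : Λ.Path}
    (hw : ∀ q : Λ.Path, q.r = p.s → w (p.append q) = κ * w q) (q : Λ.Path) {e : Λ.Path}
    (hd : Λ.degree p ≤ Λ.degree e) :
    φ (T.t p * (T.t q * star (T.t e))) = κ * φ (T.t q * star (T.t e) * T.t p) := by
  rw [← mul_assoc, mul_assoc (T.t q)]
  by_cases hpe : p ≤ e
  · obtain ⟨f, hf, rfl⟩ := hpe
    rw [T.star_append_mul hf]
    by_cases hqf : q = f
    · rw [hqf, ← T.t_append hf, hφ.map_self, hφ.map_self, hw f hf, Complex.ofReal_mul]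
    · rw [hφ.map_of_ne hqf, mul_zero]
      by_cases hq : q.r = p.s
      · rw [← T.t_append hq, hφ.map_of_ne fun h => hqf (Path.append_left_cancel hq hf h)]
      · rw [T.mul_eq_zero hq, zero_mul, map_zero]
  · rw [T.star_mul_eq_zero_of_not_le hd hpe, mul_zero, map_zero, mul_zero]
    by_cases hq : q.r = p.s
    · rw [← T.t_append hq, hφ.map_of_ne fun h => hpe ((Path.le_append hq).trans_eq h)]
    · rw [T.mul_eq_zero hq, zero_mul, map_zero]

theorem map_t_mul_monomial (hφ : T.IsDiagonal φ w) {p : Λ.Path}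
    (hw : ∀ q : Λ.Path, q.r = p.s → w (p.append q) = κ * w q) (q e : Λ.Path) :
    φ (T.t p * (T.t q * star (T.t e))) = κ * φ (T.t q * star (T.t e) * T.t p) := by
  by_cases h : q.s = e.s
  · rw [T.mul_star_eq_sum h (Λ.degree p), Finset.mul_sum, Finset.sum_mul, map_sum, map_sum,
      Finset.mul_sum]
    refine Finset.sum_congr rfl fun f hf => hφ.map_t_mul_monomial_of_degree_le hw _ ?_
    obtain ⟨hfr, hfd⟩ := (Λ.mem_into _ _ _).1 hf
    rw [Path.degree_append (hfr.trans h), hfd]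
    exact le_add_self
  · rw [T.mul_star_eq_zero h, mul_zero, zero_mul, map_zero, mul_zero]

theorem map_t_mul (hφ : T.IsDiagonal φ w) (hT : Dense (T.monomialSpan : Set B)) {p : Λ.Path}
    (hw : ∀ q : Λ.Path, q.r = p.s → w (p.append q) = κ * w q) (b : B) :
    φ (T.t p * b) = κ * φ (b * T.t p) :=
  DFunLike.congr_fun (clm_ext hT (φ := φ.comp (ContinuousLinearMap.mul ℂ B (T.t p)))
    (ψ := (κ : ℂ) • φ.comp ((ContinuousLinearMap.mul ℂ B).flip (T.t p)))
    (hφ.map_t_mul_monomial hw)) b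

theorem map_star_t_mul (hφ : T.IsDiagonal φ w) (hT : Dense (T.monomialSpan : Set B))
    {p : Λ.Path} (hκ : κ ≠ 0) (hw : ∀ q : Λ.Path, q.r = p.s → w (p.append q) = κ * w q) (b : B) :
    φ (star (T.t p) * b) = (κ : ℂ)⁻¹ * φ (b * star (T.t p)) := by
  have h := congrArg star (hφ.map_t_mul hT hw (star b))
  rw [← hφ.map_star hT, star_mul', ← hφ.map_star hT, RCLike.star_def, Complex.conj_ofReal,
    star_mul, star_mul, star_star] at h
  rw [h, inv_mul_cancel_left₀ (Complex.ofReal_ne_zero.2 hκ)]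

theorem map_monomial_mul (hφ : T.IsDiagonal φ w) (hT : Dense (T.monomialSpan : Set B))
    {κ : Λ.Path → ℝ} (hκ : ∀ p, κ p ≠ 0)
    (hw : ∀ p q : Λ.Path, q.r = p.s → w (p.append q) = κ p * w q) (p q : Λ.Path) (b : B) :
    φ (T.t p * star (T.t q) * b) = (κ p / κ q) * φ (b * (T.t p * star (T.t q))) := by
  rw [mul_assoc, hφ.map_t_mul hT (hw p), mul_assoc, hφ.map_star_t_mul hT (hκ q) (hw q), mul_assoc,
    ← mul_assoc, div_eq_mul_inv]

end IsDiagonal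

end CKFamily

theorem IsProbabilityWeight.exists_isCStarState {w : Λ.Path → ℝ} (hw : IsProbabilityWeight w)
    (hΛ : Λ.NoSources) :
    ∃ φ : Λ.CStar →L[ℂ] ℂ, IsCStarState φ ∧ Λ.genFamily.IsDiagonal φ w := by
  obtain ⟨φ, hnorm, hpos, hφ⟩ := hw.exists_isDiagonal hΛ
  exact ⟨φ, ⟨hpos, hnorm.antisymm (hφ.one_le_norm hw)⟩, hφ⟩

end KGraph

/-! ### The KMS condition on eigenvectors of the dynamics -/

theorem eq_of_differentiable_of_eqOn_real {E : Type*} [NormedAddCommGroup E] [NormedSpace ℂ E]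
    [CompleteSpace E] {f g : ℂ → E} (hf : Differentiable ℂ f) (hg : Differentiable ℂ g)
    (h : ∀ t : ℝ, f t = g t) : f = g := by
  have hreal : Filter.Tendsto ((↑) : ℝ → ℂ) (nhdsWithin 0 {0}ᶜ) (nhdsWithin 0 {0}ᶜ) :=
    Complex.continuous_ofReal.continuousWithinAt.tendsto_nhdsWithin fun t ht =>
      Complex.ofReal_ne_zero.2 ht
  exact AnalyticOnNhd.eq_of_frequently_eq (z₀ := 0) (fun z _ => hf.analyticAt z)
    (fun z _ => hg.analyticAt z) (hreal.frequently (Filter.Frequently.of_forall h))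

section KMS

variable {A : Type*} [NonUnitalCStarAlgebra A] {α : ℝ → (A ≃⋆ₐ[ℂ] A)} {φ : A →L[ℂ] ℂ}

theorem IsEntireExtension.exp_mul_apply_mul_eq {a b : A} {F : ℂ → A}
    (hF : IsEntireExtension α a F) (hφ : ∀ t a, φ (α t a) = φ a) {θ : ℝ}
    (hb : ∀ t : ℝ, α t b = Complex.exp (Complex.I * t * θ) • b) (z : ℂ) :
    Complex.exp (Complex.I * z * θ) * φ (b * F z) = φ (b * a) := by
  have hdiff : Differentiable ℂ fun z => φ (b * F z) :=
    (φ.comp (ContinuousLinearMap.mul ℂ A b)).differentiable.comp hF.1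
  have hexp : Differentiable ℂ fun z : ℂ => Complex.exp (Complex.I * z * θ) := by fun_prop
  refine congrFun (eq_of_differentiable_of_eqOn_real (g := fun _ => φ (b * a)) (hexp.mul hdiff)
    (differentiable_const _) fun t => ?_) z
  calc Complex.exp (Complex.I * t * θ) * φ (b * F t) = φ (α t b * α t a) := by
        rw [hF.2 t, hb, smul_mul_assoc, map_smul, smul_eq_mul]
    _ = φ (b * a) := by rw [← map_mul, hφ]

theorem IsCStarState.isKMSState {β : ℝ} (hφ : IsCStarState φ) (hinv : ∀ t a, φ (α t a) = φ a)
    {s : Set A} (hs : Dense (Submodule.span ℂ s : Set A))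
    (h : ∀ b ∈ s, ∃ θ : ℝ, (∀ t : ℝ, α t b = Complex.exp (Complex.I * t * θ) • b) ∧
      ∀ a, φ (b * a) = Real.exp (-β * θ) * φ (a * b)) : IsKMSState α β φ := by
  refine ⟨hφ, fun a b F _ hF _ => ?_⟩
  refine DFunLike.congr_fun (ContinuousLinearMap.ext_on hs
    (f := φ.comp (ContinuousLinearMap.mul ℂ A a))
    (g := φ.comp ((ContinuousLinearMap.mul ℂ A).flip (F (Complex.I * β)))) fun b hb => ?_) b
  change φ (a * b) = φ (b * F (Complex.I * β))
  obtain ⟨θ, heigen, hflip⟩ := h b hb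
  have hexp : Complex.exp (Complex.I * (Complex.I * β) * θ) = Real.exp (-β * θ) := by
    rw [← mul_assoc, Complex.I_mul_I]
    push_cast
    ring_nf
  have hF := hF.exp_mul_apply_mul_eq hinv heigen (Complex.I * β)
  rw [hflip a, hexp] at hF
  exact (mul_left_cancel₀ (Complex.ofReal_ne_zero.2 (Real.exp_ne_zero _)) hF).symm

end KMS

/-! ### Diagonal KMS states -/

namespace KGraph

variable {k : ℕ} {V : Type u} [SmallCategory V] {Λ : KGraph k V} [Λ.IsFinite]

/-- The linear form `n ↦ ∑ n_i log C_i`, so that `C^{zn} = exp (z · logPow C n)` for `C` with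
positive entries. -/
noncomputable def logPow (C : Fin k → ℝ) (n : Fin k → ℕ) : ℝ := ∑ i, n i * Real.log (C i)

theorem logPow_add (C : Fin k → ℝ) (m n : Fin k → ℕ) :
    logPow C (m + n) = logPow C m + logPow C n := by
  simp only [logPow, Pi.add_apply, Nat.cast_add, add_mul, Finset.sum_add_distrib]

theorem prod_rpow_eq_exp {C : Fin k → ℝ} (hC : ∀ i, 0 < C i) (ω : ℝ) (n : Fin k → ℕ) :
    ∏ i, C i ^ (-(ω * (n i : ℝ))) = Real.exp (-ω * logPow C n) := by
  rw [logPow, Finset.mul_sum, Real.exp_sum]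
  refine Finset.prod_congr rfl fun i _ => ?_
  rw [Real.rpow_def_of_pos (hC i)]
  ring_nf

theorem torusPow_exp_log (C : Fin k → ℝ) (t : ℝ) (n : Fin k → ℕ) :
    (torusPow (fun i => Circle.exp (t * Real.log (C i))) n : ℂ) =
      Complex.exp (Complex.I * t * logPow C n) := by
  rw [logPow, Complex.ofReal_sum, Finset.mul_sum, Complex.exp_sum, torusPow]
  refine (map_prod Circle.coeHom _ _).trans (Finset.prod_congr rfl fun i _ => ?_)
  change (Circle.exp (t * Real.log (C i)) : ℂ) ^ n i = _
  rw [Circle.coe_exp, ← Complex.exp_nat_mul]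
  push_cast
  ring_nf

theorem dynamics_monomial (C : Fin k → ℝ) (t : ℝ) (p q : Λ.Path) :
    Λ.dynamics C t (Λ.genFamily.t p * star (Λ.genFamily.t q)) =
      Complex.exp (Complex.I * t * (logPow C (Λ.degree p) - logPow C (Λ.degree q) : ℝ)) •
        (Λ.genFamily.t p * star (Λ.genFamily.t q)) := by
  change Λ.dynamics C t (Λ.gen p * star (Λ.gen q)) = _ • (Λ.gen p * star (Λ.gen q))
  rw [dynamics, map_mul, map_star, gauge_gen, gauge_gen, star_smul, smul_mul_smul_comm,
    torusPow_exp_log, torusPow_exp_log, RCLike.star_def, ← Complex.exp_conj, ← Complex.exp_add]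
  simp only [map_mul, Complex.conj_I, Complex.conj_ofReal]
  push_cast
  ring_nf

variable {φ : Λ.CStar →L[ℂ] ℂ} {w : Λ.Path → ℝ}

open scoped CStarAlgebra in
theorem CKFamily.IsDiagonal.map_dynamics (hφ : Λ.genFamily.IsDiagonal φ w) (C : Fin k → ℝ) (t : ℝ)
    (a : Λ.CStar) : φ (Λ.dynamics C t a) = φ a := by
  let αt : Λ.CStar →L[ℂ] Λ.CStar :=
    { toFun := Λ.dynamics C t
      map_add' := map_add _
      map_smul' := map_smul _
      cont := map_continuous (Λ.dynamics C t) }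
  refine DFunLike.congr_fun
    (CKFamily.clm_ext Λ.dense_monomialSpan (φ := φ.comp αt) (ψ := φ) fun p q => ?_) a
  change φ (Λ.dynamics C t (Λ.genFamily.t p * star (Λ.genFamily.t q))) = _
  rw [dynamics_monomial, map_smul, smul_eq_mul]
  by_cases h : p = q
  · rw [h, sub_self, Complex.ofReal_zero, mul_zero, Complex.exp_zero, one_mul]
  · rw [hφ.map_of_ne h, mul_zero]

theorem CKFamily.IsDiagonal.isKMSState (hφ : Λ.genFamily.IsDiagonal φ w) (hstate : IsCStarState φ)
    {C : Fin k → ℝ} {ω : ℝ} (hw : ∀ p q : Λ.Path, q.r = p.s →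
      w (p.append q) = Real.exp (-ω * logPow C (Λ.degree p)) * w q) :
    IsKMSState (Λ.dynamics C) ω φ := by
  refine hstate.isKMSState (hφ.map_dynamics C) Λ.dense_monomialSpan ?_
  rintro _ ⟨⟨p, q⟩, rfl⟩
  refine ⟨_, fun t => dynamics_monomial C t p q, fun a => ?_⟩
  rw [hφ.map_monomial_mul Λ.dense_monomialSpan (fun p => (Real.exp_pos _).ne') hw p q a, mul_sub,
    Real.exp_sub, Complex.ofReal_div]

end KGraph

/-! ### Measures of the ranges in a semibranching system -/

theorem measure_eq_sum_of_ae_partition {X : Type*} [MeasurableSpace X] {μ : Measure X} {ι : Type*}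
    {s : Finset ι} {A : ι → Set X} (hA : ∀ i ∈ s, NullMeasurableSet (A i) μ)
    (hcover : μ (⋃ i ∈ s, A i)ᶜ = 0)
    (hdisj : ∀ i ∈ s, ∀ j ∈ s, i ≠ j → μ (A i ∩ A j) = 0) {E : Set X}
    (hE : NullMeasurableSet E μ) : μ E = ∑ i ∈ s, μ (E ∩ A i) := by
  rw [← measure_biUnion_finset₀ (fun i hi j hj hij => ?_) fun i hi => hE.inter (hA i hi),
    ← Set.inter_iUnion₂]
  · exact (measure_inter_conull hcover).symm
  · exact measure_mono_null (Set.inter_subset_inter Set.inter_subset_right Set.inter_subset_right)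
      (hdisj i hi j hj hij)

namespace KGraph.SemibranchingSystem

variable {k : ℕ} {V : Type u} [SmallCategory V] {Λ : KGraph k V}
  {X : Type*} [MeasurableSpace X] {μ : Measure X} (S : Λ.SemibranchingSystem μ)

theorem measurableSet_D (p : Λ.Path) : MeasurableSet (S.D p) :=
  (S.semibranching (Λ.degree p)).measurable_domain ⟨p, rfl⟩

theorem nullMeasurableSet_R (p : Λ.Path) : NullMeasurableSet (S.R p) μ :=
  (S.semibranching (Λ.degree p)).measurable_range ⟨p, rfl⟩

theorem R_vertex (v : V) : S.R (Λ.vertex v) = S.D (Λ.vertex v) :=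
  (Set.image_congr fun x hx => S.vertex_id v x hx).trans (Set.image_id' _)

theorem measure_D (p : Λ.Path) : μ (S.D p) = μ (S.D (Λ.vertex p.s)) := by
  obtain ⟨f⟩ := p
  have h := S.domain_comp f (𝟙 _)
  rw [Category.id_comp] at h
  exact measure_congr h

theorem R_subset_R_vertex (p : Λ.Path) : S.R p ≤ᵐ[μ] S.R (Λ.vertex p.r) := by
  rw [R_vertex]
  obtain ⟨f⟩ := p
  exact S.range_subset (𝟙 _) f

theorem measure_R_inter_R {p q : Λ.Path} (hd : Λ.degree p = Λ.degree q) (h : p ≠ q) :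
    μ (S.R p ∩ S.R q) = 0 :=
  (S.semibranching (Λ.degree q)).disjoint ⟨p, hd⟩ ⟨q, rfl⟩ fun h' => h (Subtype.ext_iff.1 h')

theorem measure_R_vertex_inter_R {v : V} {p : Λ.Path} (h : v ≠ p.r) :
    μ (S.R (Λ.vertex v) ∩ S.R p) = 0 := by
  have hd : Λ.degree (Λ.vertex v) = Λ.degree (Λ.vertex p.r) := by
    rw [Path.degree_vertex, Path.degree_vertex]
  exact measure_mono_null_ae ((Filter.EventuallyLE.refl _ _).inter (S.R_subset_R_vertex p))
    (S.measure_R_inter_R hd (Path.vertex_injective.ne h))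

theorem measure_R_of_isRNDerivOn_const {p : Λ.Path} {c : ℝ≥0∞}
    (h : IsRNDerivOn μ (S.D p) (S.τ p) fun _ => c) :
    μ (S.R p) = c * μ (S.R (Λ.vertex p.s)) := by
  rw [R, h.2 _ (S.measurableSet_D p) subset_rfl, setLIntegral_const, S.measure_D, S.R_vertex]

variable {κ : (Fin k → ℕ) → ℝ}

theorem real_R_append (hκ : ∀ n, 0 ≤ κ n) (hκ_add : ∀ m n, κ (m + n) = κ m * κ n)
    (hΦ : ∀ p, IsRNDerivOn μ (S.D p) (S.τ p) fun _ => ENNReal.ofReal (κ (Λ.degree p)))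
    {p q : Λ.Path} (h : q.r = p.s) :
    μ.real (S.R (p.append q)) = κ (Λ.degree p) * μ.real (S.R q) := by
  have hR : ∀ p, μ.real (S.R p) = κ (Λ.degree p) * μ.real (S.R (Λ.vertex p.s)) := fun p => by
    simp only [Measure.real, S.measure_R_of_isRNDerivOn_const (hΦ p), ENNReal.toReal_mul,
      ENNReal.toReal_ofReal (hκ _)]
  rw [hR, hR q, Path.degree_append h, Path.append_s h, hκ_add, mul_assoc]

variable [Λ.IsFinite]

theorem measure_compl_iUnion_R (n : Fin k → ℕ) : μ (⋃ p ∈ Λ.ofDegree n, S.R p)ᶜ = 0 :=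
  measure_mono_null (Set.compl_subset_compl.2 <| Set.iUnion_subset fun p =>
    Set.subset_biUnion_of_mem (u := S.R) (mem_ofDegree.2 p.2)) (S.semibranching n).cover

theorem measure_eq_sum_inter_R {E : Set X} (hE : NullMeasurableSet E μ) (n : Fin k → ℕ) :
    μ E = ∑ p ∈ Λ.ofDegree n, μ (E ∩ S.R p) :=
  measure_eq_sum_of_ae_partition (fun p _ => S.nullMeasurableSet_R p)
    (S.measure_compl_iUnion_R n) (fun _ hp _ hq =>
      S.measure_R_inter_R ((mem_ofDegree.1 hp).trans (mem_ofDegree.1 hq).symm)) hE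

theorem sum_measure_R (n : Fin k → ℕ) : ∑ p ∈ Λ.ofDegree n, μ (S.R p) = μ Set.univ := by
  rw [S.measure_eq_sum_inter_R nullMeasurableSet_univ n]
  simp only [Set.univ_inter]

theorem measure_R_vertex_eq_sum (v : V) (n : Fin k → ℕ) :
    μ (S.R (Λ.vertex v)) = ∑ p ∈ Λ.into v n, μ (S.R p) := by
  classical
  rw [S.measure_eq_sum_inter_R (S.nullMeasurableSet_R _) n]
  symm
  refine Finset.sum_subset_zero_on_sdiff (fun p hp => ?_) (fun p hp => ?_) fun p hp => ?_
  · exact mem_ofDegree.2 ((Λ.mem_into _ _ _).1 hp).2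
  · rw [Finset.mem_sdiff, mem_ofDegree, Λ.mem_into] at hp
    exact S.measure_R_vertex_inter_R fun h => hp.2 ⟨h.symm, hp.1⟩
  · obtain ⟨rfl, -⟩ := (Λ.mem_into _ _ _).1 hp
    exact measure_congr (Filter.inter_eventuallyEq_right.2 (S.R_subset_R_vertex p)).symm

include S in
theorem noSources : Λ.NoSources := fun v n => by
  by_contra! hempty
  refine (S.vertex_pos v).ne' ?_
  rw [← S.R_vertex, S.measure_R_vertex_eq_sum v n]
  refine Finset.sum_eq_zero fun p hp => ?_
  obtain ⟨hr, hd⟩ := (Λ.mem_into _ _ _).1 hp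
  exact absurd hd (hempty p hr)

theorem isProbabilityWeight_real_R [IsProbabilityMeasure μ] (hκ : ∀ n, 0 ≤ κ n)
    (hκ_add : ∀ m n, κ (m + n) = κ m * κ n)
    (hΦ : ∀ p, IsRNDerivOn μ (S.D p) (S.τ p) fun _ => ENNReal.ofReal (κ (Λ.degree p))) :
    IsProbabilityWeight fun p => μ.real (S.R p) where
  nonneg _ := measureReal_nonneg
  eq_sum_append p n := by
    have happend := fun {q} => S.real_R_append hκ hκ_add hΦ (p := p) (q := q)
    calc μ.real (S.R p) = κ (Λ.degree p) * μ.real (S.R (Λ.vertex p.s)) := by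
          rw [← happend rfl, Path.append_vertex rfl]
      _ = ∑ e ∈ Λ.into p.s n, κ (Λ.degree p) * μ.real (S.R e) := by
          simp only [Measure.real, S.measure_R_vertex_eq_sum _ n,
            ENNReal.toReal_sum fun _ _ => measure_ne_top μ _, Finset.mul_sum]
      _ = ∑ e ∈ Λ.into p.s n, μ.real (S.R (p.append e)) :=
          Finset.sum_congr rfl fun e he => (happend ((Λ.mem_into _ _ _).1 he).1).symm
  sum_ofDegree n := by
    simp only [Measure.real]
    rw [← ENNReal.toReal_sum fun _ _ => measure_ne_top μ _, S.sum_measure_R, measure_univ,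
      ENNReal.toReal_one]

end KGraph.SemibranchingSystem

open scoped Classical in
theorem mainTheorem3_general {k : ℕ} {V : Type u} [SmallCategory V] (Λ : KGraph k V) [Λ.IsFinite]
    {X : Type*} [MeasurableSpace X] (μ : Measure X) [IsProbabilityMeasure μ]
    (S : Λ.SemibranchingSystem μ) (ω : ℝ) (C : Fin k → ℝ) (hC : ∀ i, 0 < C i)
    (hΦ : ∀ p : Λ.Path, IsRNDerivOn μ (S.D p) (S.τ p)
      (fun _ => ENNReal.ofReal (∏ i, C i ^ (-(ω * (Λ.degree p i : ℝ)))))) :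
    ∃ φ : Λ.CStar →L[ℂ] ℂ,
      (∀ p q : Λ.Path,
        φ (Λ.gen p * star (Λ.gen q)) = if p = q then ((μ.real (S.R p) : ℝ) : ℂ) else 0) ∧
      IsKMSState (Λ.dynamics C) ω φ ∧
      ∀ ψ : Λ.CStar →L[ℂ] ℂ,
        (∀ p q : Λ.Path,
          ψ (Λ.gen p * star (Λ.gen q)) = if p = q then ((μ.real (S.R p) : ℝ) : ℂ) else 0) →
        ψ = φ := by
  let κ : (Fin k → ℕ) → ℝ := fun n => Real.exp (-ω * KGraph.logPow C n)
  have hκ : ∀ n, 0 ≤ κ n := fun n => (Real.exp_pos _).le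
  have hκ_add : ∀ m n, κ (m + n) = κ m * κ n := fun m n => by
    rw [← Real.exp_add, ← mul_add, ← KGraph.logPow_add]
  simp only [KGraph.prod_rpow_eq_exp hC] at hΦ
  obtain ⟨φ, hstate, hφ⟩ :=
    (S.isProbabilityWeight_real_R hκ hκ_add hΦ).exists_isCStarState S.noSources
  exact ⟨φ, hφ, hφ.isKMSState hstate fun p q => S.real_R_append hκ hκ_add hΦ,
    fun ψ hψ => (hφ.eq hψ Λ.dense_monomialSpan).symm⟩

open scoped Classical in
theorem mainTheorem3 {k : ℕ} {V : Type u} [SmallCategory V] (Λ : KGraph k V) [Λ.IsFinite]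
    (hΛ : Λ.NoSources)
    {X : Type*} [MeasurableSpace X] (μ : Measure X) [IsProbabilityMeasure μ]
    (S : Λ.SemibranchingSystem μ)
    (ω : ℝ) (hω : 0 < ω) (C : Fin k → ℝ) (hC : ∀ i, 0 < C i)
    (hΦ : ∀ p : Λ.Path, IsRNDerivOn μ (S.D p) (S.τ p)
      (fun _ => ENNReal.ofReal (∏ i, C i ^ (-(ω * (Λ.degree p i : ℝ)))))) :
    ∃ φ : Λ.CStar →L[ℂ] ℂ,
      (∀ p q : Λ.Path,
        φ (Λ.gen p * star (Λ.gen q)) = if p = q then ((μ.real (S.R p) : ℝ) : ℂ) else 0) ∧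
      IsKMSState (Λ.dynamics C) ω φ ∧
      ∀ ψ : Λ.CStar →L[ℂ] ℂ,
        (∀ p q : Λ.Path,
          ψ (Λ.gen p * star (Λ.gen q)) = if p = q then ((μ.real (S.R p) : ℝ) : ℂ) else 0) →
        ψ = φ :=
  mainTheorem3_general Λ μ S ω C hC hΦ
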